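/- All graphs are finite, simple and undirected. An $r$-decomposition of the complete graph $K_n$ on $[n]$ is a tuple $(G_1,\dots,G_r)$ of spanning subgraphs of $K_n$ (edgeless ones allowed) such that every edge of $K_n$ lies in exactly one $G_i$. For a nonnegative integer valued graph parameter $\beta$, let $$\mathrm{NG}^{\Pi}_{\beta}(r;n)=\max\{\beta(G_1)\cdots\beta(G_r)\},$$ the maximum being over all $r$-decompositions of $K_n$ (the Nordhaus–Gaddum product upper bound). **Parameters.** - $\eta(G)$ (Hadwiger number) is the maximum order of a clique minor of $G$. - The four width parameters are $0$ on edgeless graphs. If $G$ has an edge, then $\mathrm{tw}(G)$ (tree-width), $\mathrm{la}(G)$ (largeur d'arborescence), $\mathrm{pw}(G)$ (path-width), $\mathrm{ppw}(G)$ (proper path-width) is the minimum $k\ge 1$ such that $G$ is (isomorphic to) a subgraph of, respectively, a $k$-tree, a two-sided $k$-tree, a $k$-caterpillar, a linear $k$-tree. Each of these is built from $K_{k+1}$ by adding vertices one at a time, each new vertex being joined to exactly the vertices of an existing $K_k$. For a $k$-tree this $K_k$ is arbitrary. For a two-sided $k$-tree, it contains a vertex whose current degree is $k$, or it is the $K_k$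 to which some previous new vertex was joined. For a $k$-caterpillar, it is a $k$-subset of the $(k+1)$-clique added in the previous step (of the initial $K_{k+1}$ at the first step). For a linear $k$-tree, it contains the vertex added in the previous step (no restriction at the first step). - For $G$ with vertex set $[n]$, let $\mathcal S(G)$ be the set of real symmetric $n\times n$ matrices $A$ such that for all $i\ne j$, $a_{ij}\ne0$ if and only if $\{i,j\}\in E(G)$ (the diagonal is free). A real symmetric matrix $A$ has the Strong Arnold Property if the only real symmetric matrix $X$ with $AX=O$, $A\circ X=O$ and $I\circ X=O$ is $X=O$, where $\circ$ is the entrywise product. Then $\xi(G)$ is the maximum nullity of a matrix in $\mathcal S(G)$ with the Strong Arnold Property; $\nu(G)$ is the maximum nullity of a positive semidefinite such matrix; and $\mu(G)$ is the maximum nullity of such a matrix that has exactly one negative eigenvalue (counted with multiplicity) and all off-diagonal entries $\le 0$. **Theorem 1.4.** Fix an integer $r\ge 2$. (a) For $\beta\in\{\mathrm{tw},\mathrm{la},\mathrm{pw},\mathrm{ppw}\}$, $$\lim_{n\to\infty}\frac{\mathrm{NG}^{\Pi}_{\beta}(r;n)}{n^r}=1.$$ (b) For $\beta\in\{\eta,\nu,\mu,\xi\}$,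 $\mathrm{NG}^{\Pi}_{\beta}(r;n)=\Theta(n^r)$ as $n\to\infty$. Specifically, as $n\to\infty$, $$\left\lceil\sqrt{2r+\tfrac14}-\tfrac12\right\rceil^{-r}-o(1)\ \le\ \frac{\mathrm{NG}^{\Pi}_{\beta}(r;n)}{n^r}\ \le\ (\sqrt r)^{-r}+o(1).$$ -/

import Mathlib

open Filter Topology Asymptotics

noncomputable section

namespace NordhausGaddum

/-- A graph parameter with values in the nonnegative integers, on graphs with vertex set `[n]`. -/
abbrev GraphParameter : Type := (n : ℕ) → SimpleGraph (Fin n) → ℕ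

/-! ### Decompositions and the product upper bound -/

/-- `G 0, …, G (r - 1)` is an `r`-decomposition of the complete graph on `[n]`: every edge of the
complete graph is an edge of exactly one of the spanning subgraphs `G i`. Some of the `G i` may be
edgeless. -/
def IsDecomposition {r n : ℕ} (G : Fin r → SimpleGraph (Fin n)) : Prop :=
  ∀ u v : Fin n, u ≠ v → ∃! i : Fin r, (G i).Adj u v

/-- The Nordhaus-Gaddum product upper bound: the maximum of `β(G₁) ⋯ β(G_r)` over all
`r`-decompositions of `K_n`. (The set is finite, and nonempty for `r ≥ 1`.) -/
def ngProdUpper (β : GraphParameter) (r n : ℕ) : ℕ :=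
  sSup {p : ℕ | ∃ G : Fin r → SimpleGraph (Fin n), IsDecomposition G ∧ p = ∏ i, β n (G i)}

/-! ### The Hadwiger number -/

/-- `H` is a minor of `G`, through branch sets: disjoint vertex sets of `G`, each inducing a
(nonempty) connected subgraph, with an edge of `G` between any two of them whose labels are
adjacent in `H`. -/
def IsMinor {W V : Type*} (H : SimpleGraph W) (G : SimpleGraph V) : Prop :=
  ∃ B : W → Set V,
    (∀ a, (G.induce (B a)).Connected) ∧
    (∀ a b, a ≠ b → Disjoint (B a) (B b)) ∧
    (∀ a b, H.Adj a b → ∃ u ∈ B a, ∃ v ∈ B b, G.Adj u v)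

/-- The Hadwiger number `η`: the maximum order of a clique minor. -/
def hadwiger : GraphParameter := fun _ G =>
  sSup {k : ℕ | IsMinor (⊤ : SimpleGraph (Fin k)) G}

/-! ### Tree-width and its variants

The vertices of a graph on `Fin m` are thought of as added one at a time in the order
`0, 1, …, m - 1`; the graph present before vertex `i` is added is the subgraph induced on
`{j | j < i}`. -/

/-- The vertices to which `i` is connected when it is added. -/
def earlierNbrs {m : ℕ} (H : SimpleGraph (Fin m)) (i : Fin m) : Set (Fin m) :=
  {j | j < i ∧ H.Adj j i}

/-- `H` is a `k`-tree built in the order `0, 1, …, m - 1`: start with a complete graph on the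
`k + 1` vertices `0, …, k`, and connect each new vertex to an existing clique on `k` vertices. -/
structure IsKTree (k : ℕ) {m : ℕ} (H : SimpleGraph (Fin m)) : Prop where
  order_ge : k + 1 ≤ m
  start_complete : ∀ i j : Fin m, i.val ≤ k → j.val ≤ k → i ≠ j → H.Adj i j
  clique : ∀ i : Fin m, k < i.val → H.IsClique (earlierNbrs H i)
  clique_size : ∀ i : Fin m, k < i.val → (earlierNbrs H i).ncard = k

/-- Linear `k`-tree: each new vertex is connected to a facet that includes the vertex added in the
previous step (the first new vertex `k + 1` is connected to any facet of the initial clique). -/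
structure IsLinearKTree (k : ℕ) {m : ℕ} (H : SimpleGraph (Fin m)) : Prop
    extends IsKTree k H where
  adj_prev : ∀ i j : Fin m, k < j.val → j.val + 1 = i.val → j ∈ earlierNbrs H i

/-- `k`-caterpillar: each new vertex is connected to the vertices of a facet of the maximal clique
added in the previous step. If `j` was added just before `i`, this maximal clique consists of `j`
and the earlier neighbours of `j` (for `j = k` it is the initial clique `{0, …, k}`). -/
structure IsKCaterpillar (k : ℕ) {m : ℕ} (H : SimpleGraph (Fin m)) : Prop
    extends IsKTree k H where
  facet_prev : ∀ i j : Fin m, k < i.val → j.val + 1 = i.val →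
    earlierNbrs H i ⊆ insert j (earlierNbrs H j)

/-- Two-sided `k`-tree: each new vertex is connected to the vertices of an existing `K_k` that
either includes a vertex of degree `k` (in the graph present at that moment) or is the `K_k` to
which some previous new vertex was connected. -/
structure IsTwoSidedKTree (k : ℕ) {m : ℕ} (H : SimpleGraph (Fin m)) : Prop
    extends IsKTree k H where
  two_sided : ∀ i : Fin m, k < i.val →
    (∃ j ∈ earlierNbrs H i, {l : Fin m | l < i ∧ H.Adj j l}.ncard = k) ∨
    (∃ j : Fin m, k < j.val ∧ j < i ∧ earlierNbrs H j = earlierNbrs H i)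

open Classical in
/-- The tree-width `tw`: `0` for an edgeless graph; otherwise the minimum `k ≥ 1` such that `G` is
(isomorphic to) a subgraph of a `k`-tree. -/
def treeWidth : GraphParameter := fun _ G =>
  if G = ⊥ then 0
  else sInf {k : ℕ | 1 ≤ k ∧ ∃ (m : ℕ) (H : SimpleGraph (Fin m)), IsKTree k H ∧ G.IsContained H}

open Classical in
/-- Largeur d'arborescence `la`: likewise with two-sided `k`-trees. -/
def largeurArborescence : GraphParameter := fun _ G =>
  if G = ⊥ then 0
  else sInf {k : ℕ | 1 ≤ k ∧
    ∃ (m : ℕ) (H : SimpleGraph (Fin m)), IsTwoSidedKTree k H ∧ G.IsContained H}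

open Classical in
/-- The path-width `pw`: likewise with `k`-caterpillars. -/
def pathWidth : GraphParameter := fun _ G =>
  if G = ⊥ then 0
  else sInf {k : ℕ | 1 ≤ k ∧
    ∃ (m : ℕ) (H : SimpleGraph (Fin m)), IsKCaterpillar k H ∧ G.IsContained H}

open Classical in
/-- The proper path-width `ppw`: likewise with linear `k`-trees. -/
def properPathWidth : GraphParameter := fun _ G =>
  if G = ⊥ then 0
  else sInf {k : ℕ | 1 ≤ k ∧
    ∃ (m : ℕ) (H : SimpleGraph (Fin m)), IsLinearKTree k H ∧ G.IsContained H}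

/-! ### Colin de Verdière type parameters -/

/-- `A ∈ S(G)`: `A` is a real symmetric matrix whose graph is `G`; the diagonal is free. -/
def IsDescribedBy {n : ℕ} (G : SimpleGraph (Fin n)) (A : Matrix (Fin n) (Fin n) ℝ) : Prop :=
  A.IsSymm ∧ ∀ i j : Fin n, i ≠ j → (A i j ≠ 0 ↔ G.Adj i j)

/-- The Strong Arnold Property: there is no nonzero real symmetric matrix `X` with `A X = O`,
`A ∘ X = O` and `I ∘ X = O`, where `∘` is the entrywise product. -/
def StrongArnold {n : ℕ} (A : Matrix (Fin n) (Fin n) ℝ) : Prop :=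
  ∀ X : Matrix (Fin n) (Fin n) ℝ, X.IsSymm → A * X = 0 → Matrix.hadamard A X = 0 →
    Matrix.hadamard (1 : Matrix (Fin n) (Fin n) ℝ) X = 0 → X = 0

/-- The nullity of a matrix: the dimension of its kernel. -/
def nullity {n : ℕ} (A : Matrix (Fin n) (Fin n) ℝ) : ℕ :=
  Module.finrank ℝ (LinearMap.ker A.mulVecLin)

/-- Exactly one negative eigenvalue, counted with multiplicity. -/
def HasOneNegEigenvalue {n : ℕ} (A : Matrix (Fin n) (Fin n) ℝ) : Prop :=
  ∃ hA : A.IsHermitian, {i : Fin n | hA.eigenvalues i < 0}.ncard = 1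

/-- `ξ(G)`: the maximum nullity among matrices in `S(G)` with the Strong Arnold Property. -/
def cdvXi : GraphParameter := fun n G =>
  sSup {q : ℕ | ∃ A : Matrix (Fin n) (Fin n) ℝ,
    IsDescribedBy G A ∧ StrongArnold A ∧ q = nullity A}

/-- `ν(G)`: the maximum nullity among positive semidefinite matrices in `S(G)` with the Strong
Arnold Property. -/
def cdvNu : GraphParameter := fun n G =>
  sSup {q : ℕ | ∃ A : Matrix (Fin n) (Fin n) ℝ,
    IsDescribedBy G A ∧ StrongArnold A ∧ A.PosSemidef ∧ q = nullity A}

/-- `μ(G)`, the Colin de Verdière number: the maximum nullity among the generalized Laplacians in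
`S(G)` (off-diagonal entries `≤ 0`) with the Strong Arnold Property and exactly one negative
eigenvalue. (The only graph without such a matrix is the graph of order `0`, where the value
is `0`.) -/
def cdvMu : GraphParameter := fun n G =>
  sSup {q : ℕ | ∃ A : Matrix (Fin n) (Fin n) ℝ,
    IsDescribedBy G A ∧ StrongArnold A ∧ HasOneNegEigenvalue A ∧
    (∀ i j : Fin n, i ≠ j → A i j ≤ 0) ∧ q = nullity A}

end NordhausGaddum

end

/-! Widths. The upper bound is trivial, since K_n contains every graph on n vertices. For the lower
bound, colour the edges of K_n at random with r colours. A union bound (`exists_coloring_joining`)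
shows that for s of order √n some colouring has, in every colour, an edge between any two disjoint
s-sets. But among any n ≥ k + 4s vertices of a k-tree there are two disjoint sets of size at least s
with no edge between them (`IsKTree.exists_separation`). So every colour class has width at least n
- 4s = n - o(n). The argument only uses that each of the four classes consists of k-trees and
contains K_{k+1}, and so it treats them uniformly.

The other parameters, upper bound. Each satisfies β² ≤ 2(n + |E|). For η this counts edges between
branch sets. For ξ, which dominates ν and μ, let q be the nullity: the symmetric matrices with
columns in the kernel form a space of dimension q(q+1)/2, and the Strong Arnold Property makes them
determined by their entries on the diagonal and the edges (`StrongArnold.choose_nullity_le`). Over a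
decomposition the squares then sum to at most n² + 2rn, and the inequality of the means bounds the
product.

The other parameters, lower bound. Let l be least with r ≤ C(l+1, 2), and split the vertices into l
nearly equal classes. This cuts K_n into C(l, 2) complete bipartite graphs and l cliques. As C(l, 2)
< r, each bipartite graph can have a colour of its own while the cliques share the remaining colours
(`exists_block_decomposition`). Explicit minors and matrices give every colour β ≥ ⌊n/l⌋ - 1. -/

namespace NordhausGaddum

/-! ### Separations in `k`-trees -/

section Separation

variable {m : ℕ} {H : SimpleGraph (Fin m)}

/-- The descendants of `i` in the elimination tree, in which the parent of a vertex is its greatest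
earlier neighbour. -/
def descendants (H : SimpleGraph (Fin m)) (i : Fin m) : Set (Fin m) :=
  {l | Relation.ReflTransGen (fun b a => IsGreatest (earlierNbrs H b) a) l i}

lemma self_mem_descendants (i : Fin m) : i ∈ descendants H i := Relation.ReflTransGen.refl

lemma descendants_trans {i j l : Fin m} (h₁ : l ∈ descendants H j) (h₂ : j ∈ descendants H i) :
    l ∈ descendants H i := Relation.ReflTransGen.trans h₁ h₂

lemma le_of_mem_descendants {i l : Fin m} (h : l ∈ descendants H i) : i ≤ l := by
  induction h with
  | refl => exact le_rfl
  | tail _ h ih => exact (h.1.1.le).trans ih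

lemma descendants_total {a b c : Fin m} (ha : c ∈ descendants H a) (hb : c ∈ descendants H b) :
    a ∈ descendants H b ∨ b ∈ descendants H a :=
  Relation.ReflTransGen.total_of_right_unique (fun _ _ _ h h' => h.unique h') ha hb

lemma exists_isGreatest_earlierNbrs {i : Fin m} (h : (earlierNbrs H i).Nonempty) :
    ∃ a, IsGreatest (earlierNbrs H i) a := by
  obtain ⟨a, ha⟩ := (Set.toFinite (earlierNbrs H i)).exists_maximal h
  exact ⟨a, ha.1, fun b hb => (le_total b a).elim id fun h => ha.2 hb h⟩

/-- Both `j` and the parent `a` of `l` are earlier neighbours of `l`, so they are equal or adjacent,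
and the argument repeats with `a` in place of `l`. Hence every edge joins a vertex to one of its
ancestors. -/
lemma mem_descendants_of_adj (hcl : ∀ i, H.IsClique (earlierNbrs H i)) {j : Fin m} (l : Fin m)
    (hjl : j < l) (h : H.Adj j l) : l ∈ descendants H j := by
  induction l using WellFoundedLT.induction with
  | ind l ih =>
    obtain ⟨a, ha⟩ := exists_isGreatest_earlierNbrs (H := H) (i := l) ⟨j, hjl, h⟩
    have hal : l ∈ descendants H a := Relation.ReflTransGen.single ha
    rcases (ha.2 ⟨hjl, h⟩ : j ≤ a).eq_or_lt with rfl | hja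
    · exact hal
    · exact descendants_trans hal (ih a ha.1.1 hja (hcl l ⟨hjl, h⟩ ha.1 hja.ne))

/-- The adjacency climbs the path from `l` to `i`: at each step `x` and the parent are two earlier
neighbours of the same vertex. -/
lemma adj_of_mem_descendants (hcl : ∀ i, H.IsClique (earlierNbrs H i)) {i l x : Fin m}
    (hl : l ∈ descendants H i) (hxi : x < i) (h : H.Adj x l) : H.Adj x i := by
  induction hl using Relation.ReflTransGen.head_induction_on with
  | refl => exact h
  | head hbc hc ih =>
    have hxc := hxi.trans_le (le_of_mem_descendants hc)
    exact ih (hcl _ ⟨hxc.trans hbc.1.1, h⟩ hbc.1 hxc.ne)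

/-- The subtree below `i` is cut off from the rest by `earlierNbrs H i`, which has at most `k`
elements in a `k`-tree. -/
lemma not_adj_of_notMem_descendants (hcl : ∀ i, H.IsClique (earlierNbrs H i)) {i l x : Fin m}
    (hl : l ∈ descendants H i) (hx : x ∉ descendants H i) (hxi : x ∉ earlierNbrs H i) :
    ¬ H.Adj l x := by
  intro h
  rcases lt_trichotomy l x with hlx | rfl | hxl
  · exact hx (descendants_trans (mem_descendants_of_adj hcl x hlx h) hl)
  · exact h.ne rfl
  · rcases descendants_total (mem_descendants_of_adj hcl l hxl h.symm) hl with h' | h'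
    · exact hx h'
    · have hlt : x < i := (le_of_mem_descendants h').lt_of_ne
        (by rintro rfl; exact hx (self_mem_descendants _))
      exact hxi ⟨hlt, adj_of_mem_descendants hcl hl hlt h.symm⟩

lemma disjoint_descendants {i c d : Fin m} (hcd : c ≠ d)
    (hc : IsGreatest (earlierNbrs H c) i) (hd : IsGreatest (earlierNbrs H d) i) {l : Fin m}
    (hlc : l ∈ descendants H c) : l ∉ descendants H d := by
  have key : ∀ {c d : Fin m}, c ≠ d → IsGreatest (earlierNbrs H c) i →
      IsGreatest (earlierNbrs H d) i → c ∉ descendants H d := by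
    intro c d hcd hc hd h
    rcases Relation.ReflTransGen.cases_head h with rfl | ⟨e, he, hed⟩
    · exact hcd rfl
    · obtain rfl := he.unique hc
      exact (le_of_mem_descendants hed).not_gt hd.1.1
  intro hld
  rcases descendants_total hlc hld with h | h
  · exact key hcd hc hd h
  · exact key hcd.symm hd hc h

lemma not_adj_descendants (hcl : ∀ i, H.IsClique (earlierNbrs H i)) {i c d : Fin m} (hcd : c ≠ d)
    (hc : IsGreatest (earlierNbrs H c) i) (hd : IsGreatest (earlierNbrs H d) i) {l x : Fin m}
    (hlc : l ∈ descendants H c) (hxd : x ∈ descendants H d) : ¬ H.Adj l x := by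
  intro h
  rcases lt_or_gt_of_ne h.ne with hlx | hxl
  · exact disjoint_descendants hcd hc hd
      (descendants_trans (mem_descendants_of_adj hcl x hlx h) hlc) hxd
  · exact disjoint_descendants hcd.symm hd hc
      (descendants_trans (mem_descendants_of_adj hcl l hxl h.symm) hxd) hlc

lemma IsKTree.isClique_earlierNbrs {k : ℕ} (h : IsKTree k H) (i : Fin m) :
    H.IsClique (earlierNbrs H i) := by
  by_cases hi : k < i.val
  · exact h.clique i hi
  · intro a ha b hb hab
    have h1 : a.val < i.val := ha.1
    have h2 : b.val < i.val := hb.1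
    exact h.start_complete a b (by omega) (by omega) hab

lemma IsKTree.ncard_earlierNbrs_le {k : ℕ} (h : IsKTree k H) (i : Fin m) :
    (earlierNbrs H i).ncard ≤ k := by
  by_cases hi : k < i.val
  · exact (h.clique_size i hi).le
  · calc (earlierNbrs H i).ncard ≤ (Set.Iio i).ncard :=
          Set.ncard_le_ncard (fun a ha => ha.1) (Set.toFinite _)
      _ = i.val := by
          rw [← Finset.coe_Iio, Set.ncard_coe_finset, Fin.card_Iio]
      _ ≤ k := by omega

lemma IsKTree.nonempty_earlierNbrs {k : ℕ} (h : IsKTree k H) (hk : 1 ≤ k) (i : Fin m)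
    (hi : 0 < i.val) : (earlierNbrs H i).Nonempty := by
  by_cases hik : k < i.val
  · exact Set.nonempty_of_ncard_ne_zero (by rw [h.clique_size i hik]; omega)
  · let z : Fin m := ⟨0, by omega⟩
    exact ⟨z, hi, h.start_complete z i (by simp [z]) (by omega)
      (by intro h; rw [← h] at hi; simp [z] at hi)⟩

lemma IsKTree.mem_descendants_zero {k : ℕ} (h : IsKTree k H) (hk : 1 ≤ k) (hm : 0 < m)
    (i : Fin m) : i ∈ descendants H ⟨0, hm⟩ := by
  induction i using WellFoundedLT.induction with
  | ind i ih =>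
    rcases Nat.eq_zero_or_pos i.val with h0 | h0
    · have : i = ⟨0, hm⟩ := Fin.ext h0
      rw [this]; exact self_mem_descendants _
    · obtain ⟨a, ha⟩ := exists_isGreatest_earlierNbrs (h.nonempty_earlierNbrs hk i h0)
      exact descendants_trans (Relation.ReflTransGen.single ha) (ih a ha.1.1)

/-- A family of small sets with large union contains a subfamily with union of moderate size. -/
lemma exists_subfamily_card_biUnion {ι α : Type*} [DecidableEq ι] [DecidableEq α]
    (T : ι → Finset α) (s : ℕ) (C : Finset ι) (hT : ∀ c ∈ C, (T c).card < s)
    (hC : s ≤ (C.biUnion T).card) :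
    ∃ D ⊆ C, s ≤ (D.biUnion T).card ∧ (D.biUnion T).card ≤ 2 * s := by
  induction C using Finset.induction_on with
  | empty => exact ⟨∅, le_rfl, hC, by simp⟩
  | insert c C hc ih =>
    by_cases h : s ≤ (C.biUnion T).card
    · obtain ⟨D, hD, h1, h2⟩ := ih (fun c hc => hT c (Finset.mem_insert_of_mem hc)) h
      exact ⟨D, hD.trans (Finset.subset_insert _ _), h1, h2⟩
    -- The union first reaches `s` here: it was below `s`, and the set just added has fewer than `s`
    -- elements.
    · refine ⟨_, le_rfl, hC, ?_⟩
      rw [Finset.biUnion_insert]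
      have h1 := Finset.card_union_le (T c) (C.biUnion T)
      have h2 := hT c (Finset.mem_insert_self _ _)
      omega

/-- If `k` is much smaller than `n`, any `n` vertices of a `k`-tree include two disjoint large sets
without an edge between them. -/
theorem IsKTree.exists_separation {k : ℕ} (h : IsKTree k H) (hk : 1 ≤ k) {n : ℕ}
    {f : Fin n → Fin m} (hf : Function.Injective f) {s : ℕ} (hs : 1 ≤ s) (hn : k + 4 * s ≤ n) :
    ∃ A B : Finset (Fin n), s ≤ A.card ∧ s ≤ B.card ∧ Disjoint A B ∧
      ∀ a ∈ A, ∀ b ∈ B, ¬ H.Adj (f a) (f b) := by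
  classical
  have hcl := h.isClique_earlierNbrs
  have hm : 0 < m := by have := h.order_ge; omega
  set T : Fin m → Finset (Fin n) := fun i => Finset.univ.filter fun x => f x ∈ descendants H i
    with hTdef
  have hmem : ∀ i x, x ∈ T i ↔ f x ∈ descendants H i := by simp [hTdef]
  have h0 : s ≤ (T ⟨0, hm⟩).card := by
    have : T ⟨0, hm⟩ = Finset.univ :=
      Finset.eq_univ_of_forall fun x => (hmem _ _).2 (h.mem_descendants_zero hk hm _)
    rw [this, Finset.card_univ, Fintype.card_fin]; omega
  -- The last vertex whose subtree contains at least `s` of the given vertices; the subtrees of its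
  -- children, which come later, contain fewer.
  obtain ⟨i, hi⟩ := (Set.toFinite {i : Fin m | s ≤ (T i).card}).exists_maximal ⟨_, h0⟩
  have his : s ≤ (T i).card := hi.1
  have hlt : ∀ c, i < c → (T c).card < s := by
    intro c hc
    by_contra hcon
    exact (hi.2 (not_lt.1 hcon) hc.le).not_gt hc
  set N : Finset (Fin n) := Finset.univ.filter fun x => f x ∈ earlierNbrs H i with hN
  set B : Finset (Fin n) := Finset.univ \ (T i ∪ N) with hB
  have hNk : N.card ≤ k := by
    calc N.card = (N.image f).card := (Finset.card_image_of_injective _ hf).symm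
      _ ≤ (earlierNbrs H i).ncard := by
        rw [← Set.ncard_coe_finset]
        refine Set.ncard_le_ncard ?_ (Set.toFinite _)
        intro y hy
        simp only [Finset.coe_image, Set.mem_image, Finset.mem_coe, hN, Finset.mem_filter] at hy
        obtain ⟨x, hx, rfl⟩ := hy
        exact hx.2
      _ ≤ k := h.ncard_earlierNbrs_le i
  by_cases hBs : s ≤ B.card
  · refine ⟨T i, B, his, hBs, ?_, ?_⟩
    · rw [Finset.disjoint_left]
      intro x hx hxB
      simp [hB, hx] at hxB
    · intro a ha b hb
      simp only [hB, Finset.mem_sdiff, Finset.mem_union, not_or] at hb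
      refine not_adj_of_notMem_descendants hcl ((hmem _ _).1 ha) (fun hh => hb.2.1 ((hmem _ _).2 hh))
        fun hh => hb.2.2 (by simp [hN, hh])
  -- Now the subtree of `i` holds at least `3 * s + 1` of the vertices, and those of the children
  -- together at least `3 * s`. A group of children with between `s` and `2 * s` of them leaves at
  -- least `s` for the remaining children.
  · have hTi : n + 1 ≤ (T i).card + k + s := by
      have h1 : (T i ∪ N).card + B.card = n := by
        rw [hB, add_comm, Finset.card_sdiff_add_card_eq_card (Finset.subset_univ _),
          Finset.card_univ, Fintype.card_fin]
      have h2 := Finset.card_union_le (T i) N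
      omega
    set C : Finset (Fin m) := Finset.univ.filter fun c => IsGreatest (earlierNbrs H c) i with hC
    have hCT : ∀ c ∈ C, (T c).card < s := fun c hc => hlt c (Finset.mem_filter.1 hc).2.1.1
    have hcover : (T i).card ≤ (C.biUnion T).card + 1 := by
      have hsub : T i ⊆ C.biUnion T ∪ Finset.univ.filter (fun x => f x = i) := by
        intro x hx
        rcases Relation.ReflTransGen.cases_tail ((hmem _ _).1 hx) with h' | ⟨c, hc, hci⟩
        · simp [h'.symm]
        · refine Finset.mem_union_left _ (Finset.mem_biUnion.2 ⟨c, ?_, (hmem _ _).2 hc⟩)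
          simpa [hC] using hci
      have h1 := (Finset.card_le_card hsub).trans (Finset.card_union_le _ _)
      have h2 : (Finset.univ.filter (fun x => f x = i)).card ≤ 1 :=
        Finset.card_le_one.2 fun a ha b hb => hf (by simp at ha hb; rw [ha, hb])
      omega
    obtain ⟨D, hDC, hD1, hD2⟩ := exists_subfamily_card_biUnion T s C hCT (by omega)
    have hne : ∀ {a b c d}, c ∈ D → d ∈ C \ D → a ∈ T c → b ∈ T d →
        a ≠ b ∧ ¬ H.Adj (f a) (f b) := by
      intro a b c d hc hd ha hb
      have hd' := Finset.mem_sdiff.1 hd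
      have hcd : c ≠ d := by rintro rfl; exact hd'.2 hc
      have h1 := (Finset.mem_filter.1 (hDC hc)).2
      have h2 := (Finset.mem_filter.1 hd'.1).2
      refine ⟨?_, not_adj_descendants hcl hcd h1 h2 ((hmem _ _).1 ha) ((hmem _ _).1 hb)⟩
      rintro rfl
      exact disjoint_descendants hcd h1 h2 ((hmem _ _).1 ha) ((hmem _ _).1 hb)
    refine ⟨D.biUnion T, (C \ D).biUnion T, hD1, ?_, ?_, ?_⟩
    · have hsub : C.biUnion T ⊆ D.biUnion T ∪ (C \ D).biUnion T := by
        rw [← Finset.union_biUnion, Finset.union_sdiff_of_subset hDC]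
      have h1 := (Finset.card_le_card hsub).trans (Finset.card_union_le _ _)
      omega
    · rw [Finset.disjoint_left]
      intro x hx hx'
      obtain ⟨c, hc, hxc⟩ := Finset.mem_biUnion.1 hx
      obtain ⟨d, hd, hxd⟩ := Finset.mem_biUnion.1 hx'
      exact (hne hc hd hxc hxd).1 rfl
    · intro a ha b hb
      obtain ⟨c, hc, hxc⟩ := Finset.mem_biUnion.1 ha
      obtain ⟨d, hd, hxd⟩ := Finset.mem_biUnion.1 hb
      exact (hne hc hd hxc hxd).2

end Separation

/-! ### Bounds for the width parameters -/

section Width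

variable {n : ℕ}

lemma isLinearKTree_top (k : ℕ) : IsLinearKTree k (⊤ : SimpleGraph (Fin (k + 1))) where
  order_ge := le_rfl
  start_complete _ _ _ _ h := h
  clique i hi := absurd i.isLt (by omega)
  clique_size i hi := absurd i.isLt (by omega)
  adj_prev i j hj _ := absurd j.isLt (by omega)

lemma isKCaterpillar_top (k : ℕ) : IsKCaterpillar k (⊤ : SimpleGraph (Fin (k + 1))) where
  toIsKTree := (isLinearKTree_top k).toIsKTree
  facet_prev i _ hi _ := absurd i.isLt (by omega)

lemma isTwoSidedKTree_top (k : ℕ) : IsTwoSidedKTree k (⊤ : SimpleGraph (Fin (k + 1))) where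
  toIsKTree := (isLinearKTree_top k).toIsKTree
  two_sided i hi := absurd i.isLt (by omega)

open Classical in
/-- The width parameter of a graph with respect to a family `P k` of graphs that play the role of
`k`-trees. -/
noncomputable def widthOf (P : ℕ → ∀ m : ℕ, SimpleGraph (Fin m) → Prop) : GraphParameter := fun _ G =>
  if G = ⊥ then 0
  else sInf {k : ℕ | 1 ≤ k ∧ ∃ (m : ℕ) (H : SimpleGraph (Fin m)), P k m H ∧ G.IsContained H}

variable {P : ℕ → ∀ m : ℕ, SimpleGraph (Fin m) → Prop}

/-- `K_n` itself is a host for `k = n - 1`. This also shows that the infimum is attained and is not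
the default value of `sInf ∅`. -/
lemma widthOf_mem (hP : ∀ k, P k (k + 1) ⊤) {G : SimpleGraph (Fin n)} (hG : G ≠ ⊥) :
    n - 1 ∈ {k : ℕ | 1 ≤ k ∧ ∃ (m : ℕ) (H : SimpleGraph (Fin m)), P k m H ∧ G.IsContained H} := by
  obtain ⟨a, b, hab⟩ := SimpleGraph.ne_bot_iff_exists_adj.1 hG
  have h1 : 2 ≤ n := by
    have h2 := a.isLt
    have h3 := b.isLt
    have h4 : a.val ≠ b.val := fun h => hab.ne (Fin.ext h)
    omega
  obtain ⟨k, rfl⟩ : ∃ k, n = k + 1 := ⟨n - 1, by omega⟩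
  exact ⟨by omega, k + 1, ⊤, hP k, SimpleGraph.IsContained.of_le le_top⟩

lemma widthOf_le (hP : ∀ k, P k (k + 1) ⊤) (G : SimpleGraph (Fin n)) : widthOf P n G ≤ n := by
  classical
  unfold widthOf
  split_ifs with hG
  · exact Nat.zero_le _
  · exact (Nat.sInf_le (widthOf_mem hP hG)).trans (Nat.sub_le _ _)

/-- A graph in which any two disjoint sets of size `s` are joined by an edge has large width. -/
lemma le_widthOf (hP : ∀ k, P k (k + 1) ⊤) (hP' : ∀ k m H, P k m H → IsKTree k H)
    {G : SimpleGraph (Fin n)} {s : ℕ} (hs : 1 ≤ s)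
    (hG : ∀ A B : Finset (Fin n), s ≤ A.card → s ≤ B.card → Disjoint A B →
      ∃ a ∈ A, ∃ b ∈ B, G.Adj a b) : n ≤ widthOf P n G + 4 * s := by
  classical
  by_contra hcon
  unfold widthOf at hcon
  split_ifs at hcon with hbot
  -- As `n > 4 * s`, there is room for two disjoint sets of size `s`, which an edgeless graph cannot
  -- join.
  · subst hbot
    obtain ⟨A, -, hA⟩ := Finset.exists_subset_card_eq (s := (Finset.univ : Finset (Fin n)))
      (n := s) (by rw [Finset.card_univ, Fintype.card_fin]; omega)
    obtain ⟨a, -, b, -, hab⟩ := hG A Aᶜ hA.ge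
      (by rw [Finset.card_compl, Fintype.card_fin]; omega) disjoint_compl_right
    exact hab
  · obtain ⟨hk, m, H, hH, ⟨f⟩⟩ := Nat.sInf_mem ⟨_, widthOf_mem hP hbot⟩
    obtain ⟨A, B, hA, hB, hAB, hno⟩ :=
      (hP' _ _ _ hH).exists_separation hk f.injective hs (by omega)
    obtain ⟨a, ha, b, hb, hab⟩ := hG A B hA hB hAB
    exact hno a ha b hb (f.toHom.map_adj hab)

end Width

/-! ### Decompositions from edge colourings -/

section Decomposition

variable {r n : ℕ}

/-- The graph formed by the edges of colour `i`. -/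
def colorGraph (f : Sym2 (Fin n) → Fin r) (i : Fin r) : SimpleGraph (Fin n) where
  Adj u v := u ≠ v ∧ f s(u, v) = i
  symm := ⟨fun u v h => ⟨h.1.symm, by rw [Sym2.eq_swap]; exact h.2⟩⟩
  loopless := ⟨fun _ h => h.1 rfl⟩

lemma isDecomposition_colorGraph (f : Sym2 (Fin n) → Fin r) : IsDecomposition (colorGraph f) :=
  fun u v huv => ⟨f s(u, v), ⟨huv, rfl⟩, fun _ hi => hi.2.symm⟩

lemma bddAbove_products (β : GraphParameter) (r n : ℕ) :
    BddAbove {p : ℕ | ∃ G : Fin r → SimpleGraph (Fin n),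
      IsDecomposition G ∧ p = ∏ i, β n (G i)} := by
  refine ((Set.finite_range fun G : Fin r → SimpleGraph (Fin n) =>
    ∏ i, β n (G i)).subset ?_).bddAbove
  rintro p ⟨G, -, rfl⟩
  exact ⟨G, rfl⟩

lemma prod_le_ngProdUpper (β : GraphParameter) {G : Fin r → SimpleGraph (Fin n)}
    (hG : IsDecomposition G) : ∏ i, β n (G i) ≤ ngProdUpper β r n :=
  le_csSup (bddAbove_products β r n) ⟨G, hG, rfl⟩

lemma pow_le_ngProdUpper (β : GraphParameter) {G : Fin r → SimpleGraph (Fin n)}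
    (hG : IsDecomposition G) {b : ℕ} (hb : ∀ i, b ≤ β n (G i)) : b ^ r ≤ ngProdUpper β r n := by
  refine le_trans ?_ (prod_le_ngProdUpper β hG)
  calc b ^ r = ∏ _i : Fin r, b := by simp
    _ ≤ _ := Finset.prod_le_prod' fun i _ => hb i

lemma exists_ngProdUpper_eq (β : GraphParameter) (hr : 0 < r) (n : ℕ) :
    ∃ G : Fin r → SimpleGraph (Fin n), IsDecomposition G ∧ ngProdUpper β r n = ∏ i, β n (G i) :=
  Nat.sSup_mem (s := {p : ℕ | ∃ G : Fin r → SimpleGraph (Fin n),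
      IsDecomposition G ∧ p = ∏ i, β n (G i)})
    ⟨_, _, isDecomposition_colorGraph fun _ => ⟨0, hr⟩, rfl⟩ (bddAbove_products β r n)

open Classical in
lemma IsDecomposition.sum_card_edgeFinset {G : Fin r → SimpleGraph (Fin n)}
    (hG : IsDecomposition G) : ∑ i, (G i).edgeFinset.card = n.choose 2 := by
  rw [← Finset.card_biUnion]
  · have : Finset.univ.biUnion (fun i => (G i).edgeFinset) =
        (⊤ : SimpleGraph (Fin n)).edgeFinset := by
      ext e
      induction e using Sym2.ind with
      | _ u v =>
        simp only [Finset.mem_biUnion, Finset.mem_univ, true_and, SimpleGraph.mem_edgeFinset,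
          SimpleGraph.mem_edgeSet, SimpleGraph.top_adj]
        exact ⟨fun ⟨i, hi⟩ => hi.ne, fun h => (hG u v h).exists⟩
    rw [this, SimpleGraph.card_edgeFinset_top_eq_card_choose_two, Fintype.card_fin]
  · intro i _ j _ hij
    rw [Function.onFun, Finset.disjoint_left]
    intro e
    induction e using Sym2.ind with
    | _ u v =>
      simp only [SimpleGraph.mem_edgeFinset, SimpleGraph.mem_edgeSet]
      exact fun hi hj => hij ((hG u v hi.ne).unique hi hj)

/-! ### The union bound over edge colourings. -/

/-- The number of functions that avoid the value `i` on `E`. -/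
lemma card_avoiding {α : Type*} [Fintype α] [DecidableEq α] (E : Finset α) (i : Fin r) :
    ((Finset.univ : Finset (α → Fin r)).filter fun f => ∀ e ∈ E, f e ≠ i).card =
      (r - 1) ^ E.card * r ^ (Fintype.card α - E.card) := by
  have : ((Finset.univ : Finset (α → Fin r)).filter fun f => ∀ e ∈ E, f e ≠ i) =
      Fintype.piFinset fun e => if e ∈ E then Finset.univ.erase i else Finset.univ := by
    ext f
    simp only [Finset.mem_filter, Finset.mem_univ, true_and, Fintype.mem_piFinset]
    refine forall_congr' fun e => ?_
    split_ifs with h <;> simp [h]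
  rw [this, Fintype.card_piFinset]
  have h2 : ∀ e : α, (if e ∈ E then (Finset.univ : Finset (Fin r)).erase i else Finset.univ).card =
      if e ∈ E then r - 1 else r := by
    intro e
    split_ifs <;> simp
  simp_rw [h2]
  rw [Finset.prod_ite, Finset.prod_const, Finset.prod_const]
  congr 2
  · simp
  · rw [← Finset.card_compl]
    congr 1
    ext; simp

/-- If `r 4ⁿ (1 - 1/r)^(s²) < 1`, then some edge colouring joins any two disjoint sets of size `s`
in every colour. -/
theorem exists_coloring_joining (hr : 0 < r) {s : ℕ}
    (h : r * 4 ^ n * (r - 1) ^ (s * s) < r ^ (s * s)) :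
    ∃ f : Sym2 (Fin n) → Fin r, ∀ i, ∀ A B : Finset (Fin n), s ≤ A.card → s ≤ B.card →
      Disjoint A B → ∃ a ∈ A, ∃ b ∈ B, (colorGraph f i).Adj a b := by
  classical
  set S := Fintype.card (Sym2 (Fin n)) with hS
  set E : Finset (Fin n) → Finset (Fin n) → Finset (Sym2 (Fin n)) := fun A B =>
    (A ×ˢ B).image fun p => s(p.1, p.2) with hE
  have hEcard : ∀ A B, Disjoint A B → (E A B).card = A.card * B.card := by
    intro A B hAB
    rw [hE, Finset.card_image_of_injOn, Finset.card_product]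
    rintro ⟨a, b⟩ hab ⟨c, d⟩ hcd heq
    simp only [Finset.coe_product, Set.mem_prod, Finset.mem_coe] at hab hcd
    rcases Sym2.eq_iff.1 heq with ⟨h1, h2⟩ | ⟨h1, h2⟩
    · exact Prod.ext h1 h2
    · simp only at h1
      exact absurd (h1 ▸ hab.1) (Finset.disjoint_right.1 hAB hcd.2)
  set bad : Finset (Sym2 (Fin n) → Fin r) :=
    (Finset.univ : Finset (Fin r × Finset (Fin n) × Finset (Fin n))).biUnion fun t =>
      Finset.univ.filter fun f => (s = t.2.1.card ∧ s = t.2.2.card ∧ Disjoint t.2.1 t.2.2) ∧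
        ∀ e ∈ E t.2.1 t.2.2, f e ≠ t.1 with hbad
  have hcard : bad.card < Fintype.card (Sym2 (Fin n) → Fin r) := by
    -- If two disjoint sets of size `s` exist, then `s * s ≤ S` and the subtraction in the exponent
    -- below is not truncated; otherwise nothing is bad. The factor `4 ^ n` counts all pairs of
    -- vertex sets.
    by_cases hex : ∃ A B : Finset (Fin n), s = A.card ∧ s = B.card ∧ Disjoint A B
    · have hsS : s * s ≤ S := by
        obtain ⟨A, B, hA, hB, hAB⟩ := hex
        calc s * s = (E A B).card := by rw [hEcard A B hAB, ← hA, ← hB]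
          _ ≤ S := Finset.card_le_univ _
      have h1 : bad.card ≤ r * 4 ^ n * ((r - 1) ^ (s * s) * r ^ (S - s * s)) := by
        refine (Finset.card_biUnion_le_card_mul _ _ ((r - 1) ^ (s * s) * r ^ (S - s * s))
          ?_).trans (le_of_eq ?_)
        · rintro ⟨i, A, B⟩ -
          by_cases hAB : s = A.card ∧ s = B.card ∧ Disjoint A B
          · simp only [hAB, true_and]
            refine le_of_eq ?_
            simp only [← hAB.1, ← hAB.2.1, and_self, true_and]
            rw [card_avoiding, hEcard A B hAB.2.2, ← hAB.1, ← hAB.2.1]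
          · simp [hAB]
        · congr 1
          rw [Finset.card_univ, Fintype.card_prod, Fintype.card_prod, Fintype.card_fin,
            Fintype.card_finset, Fintype.card_fin, ← mul_pow]
          norm_num
      have h2 : Fintype.card (Sym2 (Fin n) → Fin r) = r ^ (s * s) * r ^ (S - s * s) := by
        rw [Fintype.card_fun, Fintype.card_fin, ← pow_add, Nat.add_sub_cancel' hsS]
      rw [h2]
      refine h1.trans_lt ?_
      rw [← mul_assoc]
      exact Nat.mul_lt_mul_of_pos_right h (pow_pos hr _)
    · have : bad = ∅ := by
        rw [Finset.eq_empty_iff_forall_notMem]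
        intro f hf
        obtain ⟨t, -, ht⟩ := Finset.mem_biUnion.1 hf
        exact hex ⟨_, _, (Finset.mem_filter.1 ht).2.1⟩
      rw [this, Finset.card_empty, Fintype.card_fun, Fintype.card_fin]
      exact pow_pos hr _
  obtain ⟨f, -, hf⟩ := Finset.exists_mem_notMem_of_card_lt_card
    (s := bad) (t := Finset.univ) (by rwa [Finset.card_univ])
  refine ⟨f, fun i A B hA hB hAB => ?_⟩
  obtain ⟨A', hA', hA's⟩ := Finset.exists_subset_card_eq hA
  obtain ⟨B', hB', hB's⟩ := Finset.exists_subset_card_eq hB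
  by_contra hcon
  push Not at hcon
  refine hf (Finset.mem_biUnion.2 ⟨(i, A', B'), Finset.mem_univ _, ?_⟩)
  rw [Finset.mem_filter]
  refine ⟨Finset.mem_univ _, ⟨hA's.symm, hB's.symm, hAB.mono hA' hB'⟩, ?_⟩
  intro e he hei
  obtain ⟨⟨a, b⟩, hab, rfl⟩ := Finset.mem_image.1 he
  have hab' := Finset.mem_product.1 hab
  refine hcon a (hA' hab'.1) b (hB' hab'.2) ⟨?_, hei⟩
  rintro rfl
  exact Finset.disjoint_left.1 hAB (hA' hab'.1) (hB' hab'.2)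

end Decomposition
/-! ### Nullity and the Strong Arnold Property -/

section Matrix

open Matrix

variable {n : ℕ} {G : SimpleGraph (Fin n)} {A : Matrix (Fin n) (Fin n) ℝ}

lemma nullity_le (A : Matrix (Fin n) (Fin n) ℝ) : nullity A ≤ n := by
  exact (LinearMap.ker A.mulVecLin).finrank_le.trans (by simp)

/-- The columns of `B` are a basis of the kernel. Their independence is recorded as a left inverse,
by which a matrix `S` can be recovered from `B * S * Bᵀ`. -/
lemma exists_kernel_matrix (A : Matrix (Fin n) (Fin n) ℝ) :
    ∃ (B : Matrix (Fin n) (Fin (nullity A)) ℝ) (L : Matrix (Fin (nullity A)) (Fin n) ℝ),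
      L * B = 1 ∧ A * B = 0 := by
  set f : (Fin (nullity A) → ℝ) →ₗ[ℝ] (Fin n → ℝ) :=
    (LinearMap.ker A.mulVecLin).subtype ∘ₗ
      (Module.finBasis ℝ (LinearMap.ker A.mulVecLin)).equivFun.symm.toLinearMap with hf
  have hinj : LinearMap.ker f = ⊥ := by
    rw [LinearMap.ker_eq_bot, hf]
    exact (Submodule.subtype_injective _).comp (LinearEquiv.injective _)
  obtain ⟨g, hg⟩ := f.exists_leftInverse_of_injective hinj
  refine ⟨LinearMap.toMatrix' f, LinearMap.toMatrix' g, ?_, ?_⟩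
  · rw [← LinearMap.toMatrix'_comp, hg, LinearMap.toMatrix'_id]
  · have h0 : A.mulVecLin ∘ₗ f = 0 := by
      ext1 i
      ext1
      exact LinearMap.mem_ker.1 (((Module.finBasis ℝ (LinearMap.ker A.mulVecLin)).equivFun.symm
        (Pi.single i 1)).2)
    have h1 := LinearMap.toMatrix'_comp (Matrix.toLin' A) f
    rw [LinearMap.toMatrix'_toLin'] at h1
    rw [← h1, Matrix.toLin'_apply', h0, map_zero]

/-- The symmetric matrix with entries prescribed on unordered pairs. -/
def symMatrix {q : ℕ} (c : Sym2 (Fin q) → ℝ) : Matrix (Fin q) (Fin q) ℝ :=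
  Matrix.of fun s t => c s(s, t)

lemma symMatrix_isSymm {q : ℕ} (c : Sym2 (Fin q) → ℝ) : (symMatrix c).IsSymm := by
  ext s t
  simp [symMatrix, Sym2.eq_swap]

lemma two_mul_choose_two (q : ℕ) : 2 * (q + 1).choose 2 = q * (q + 1) := by
  rw [Nat.choose_two_right, Nat.add_sub_cancel, mul_comm (q + 1),
    Nat.mul_div_cancel' (Nat.even_mul_succ_self q).two_dvd]

open Classical in
/-- A matrix with the Strong Arnold Property has small nullity: the symmetric matrices with columns
in the kernel are determined by their entries at the diagonal and at the edges. -/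
theorem StrongArnold.choose_nullity_le (hG : IsDescribedBy G A) (hA : StrongArnold A) :
    (nullity A + 1).choose 2 ≤ n + G.edgeFinset.card := by
  obtain ⟨B, L, hLB, hAB⟩ := exists_kernel_matrix A
  generalize nullity A = q at *
  set X : (Sym2 (Fin q) → ℝ) → Matrix (Fin n) (Fin n) ℝ := fun c => B * symMatrix c * Bᵀ with hX
  have hadd : ∀ c d, X (c + d) = X c + X d := by
    intro c d
    have : symMatrix (c + d) = symMatrix c + symMatrix d := by ext; simp [symMatrix]
    simp only [hX, this, Matrix.mul_add, Matrix.add_mul]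
  have hsmul : ∀ (a : ℝ) c, X (a • c) = a • X c := by
    intro a c
    have : symMatrix (a • c) = a • symMatrix c := by ext; simp [symMatrix]
    simp only [hX, this, Matrix.mul_smul, Matrix.smul_mul]
  have hsymm : ∀ c, (X c).IsSymm := by
    intro c
    simp only [hX, Matrix.IsSymm, Matrix.transpose_mul, Matrix.transpose_transpose,
      (symMatrix_isSymm c).eq, Matrix.mul_assoc]
  -- The entries of `X c` on the diagonal and on the edges. At an edge the two equal entries are
  -- added, so that the value is defined on unordered pairs.
  set F : (Sym2 (Fin q) → ℝ) →ₗ[ℝ] ((Fin n ⊕ G.edgeFinset) → ℝ) :=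
    { toFun := fun c => Sum.elim (fun i => X c i i) fun e =>
        Sym2.lift ⟨fun i j => X c i j + X c j i, fun i j => add_comm _ _⟩ e.1
      map_add' := by
        intro c d
        ext (i | ⟨e, he⟩)
        · simp [hadd]
        · induction e using Sym2.ind with
          | _ i j => simp [hadd]; ring
      map_smul' := by
        intro a c
        ext (i | ⟨e, he⟩)
        · simp [hsmul]
        · induction e using Sym2.ind with
          | _ i j => simp [hsmul]; ring } with hF
  have hinj : Function.Injective F := by
    rw [injective_iff_map_eq_zero]
    intro c hc
    have hdiag : ∀ i, X c i i = 0 := fun i => congrFun hc (Sum.inl i)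
    have hedge : ∀ i j, G.Adj i j → X c i j = 0 := by
      intro i j hij
      have h1 : X c i j + X c j i = 0 :=
        congrFun hc (Sum.inr ⟨s(i, j), by simpa using hij⟩)
      rw [(hsymm c).apply i j] at h1
      linarith
    have hX0 : X c = 0 := by
      refine hA _ (hsymm c) ?_ ?_ ?_
      · simp only [hX, ← Matrix.mul_assoc, hAB, Matrix.zero_mul]
      · ext i j
        rw [Matrix.hadamard_apply, Matrix.zero_apply, mul_eq_zero]
        by_cases hij : i = j
        · subst hij; exact Or.inr (hdiag i)
        · by_cases h : G.Adj i j
          · exact Or.inr (hedge i j h)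
          · exact Or.inl (not_not.1 fun h' => h ((hG.2 i j hij).1 h'))
      · ext i j
        rw [Matrix.hadamard_apply, Matrix.zero_apply, mul_eq_zero]
        by_cases hij : i = j
        · subst hij; exact Or.inr (hdiag i)
        · exact Or.inl (Matrix.one_apply_ne hij)
    have hBL : Bᵀ * Lᵀ = 1 := by rw [← Matrix.transpose_mul, hLB, Matrix.transpose_one]
    have hS : symMatrix c = 0 := by
      calc symMatrix c = (L * B) * symMatrix c * (Bᵀ * Lᵀ) := by
            rw [hLB, hBL, Matrix.one_mul, Matrix.mul_one]
        _ = L * X c * Lᵀ := by simp only [hX, Matrix.mul_assoc]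
        _ = 0 := by rw [hX0]; simp
    ext e
    induction e using Sym2.ind with
    | _ s t => exact congrFun (congrFun hS s) t
  have h1 := LinearMap.finrank_le_finrank_of_injective hinj
  rw [Module.finrank_fintype_fun_eq_card, Module.finrank_fintype_fun_eq_card, Sym2.card,
    Fintype.card_sum, Fintype.card_fin, Fintype.card_fin, Fintype.card_coe] at h1
  exact h1

/-- Kernel vectors that are dual to some coordinates bound the nullity from below. -/
lemma card_le_nullity {ι : Type*} [Fintype ι] [DecidableEq ι] (x : ι → Fin n → ℝ) (c : ι → Fin n)
    (hx : ∀ s t, x s (c t) = if s = t then 1 else 0) (hA : ∀ s, A *ᵥ x s = 0) :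
    Fintype.card ι ≤ nullity A := by
  have hli : LinearIndependent ℝ x := by
    rw [Fintype.linearIndependent_iff]
    intro g hg t
    simpa [Finset.sum_apply, hx] using congrFun hg (c t)
  have hli' : LinearIndependent ℝ
      (fun s => (⟨x s, LinearMap.mem_ker.2 (hA s)⟩ : LinearMap.ker A.mulVecLin)) :=
    LinearIndependent.of_comp (LinearMap.ker A.mulVecLin).subtype hli
  exact hli'.fintype_card_le_finrank

/-- The quadratic form of `A` is nonnegative on the hyperplane orthogonal to `w`, and a plane
spanned by two eigenvectors with negative eigenvalues would meet that hyperplane. -/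
lemma hasOneNegEigenvalue_of_posSemidef {w : Fin n → ℝ} (hA : A.IsHermitian)
    (hw : (A + vecMulVec w w).PosSemidef) (hneg : ¬ A.PosSemidef) : HasOneNegEigenvalue A := by
  have hquad : ∀ x : Fin n → ℝ, 0 ≤ x ⬝ᵥ A *ᵥ x + (w ⬝ᵥ x) ^ 2 := by
    intro x
    have h := hw.dotProduct_mulVec_nonneg x
    rw [Matrix.add_mulVec, dotProduct_add, vecMulVec_mulVec] at h
    simp only [star_trivial, op_smul_eq_smul, dotProduct_smul, smul_eq_mul] at h
    rw [dotProduct_comm x w] at h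
    linarith
  set v : Fin n → Fin n → ℝ := fun i => WithLp.ofLp (hA.eigenvectorBasis i) with hv
  have hvv : ∀ i j, v i ⬝ᵥ v j = if i = j then 1 else 0 := by
    intro i j
    have := orthonormal_iff_ite.1 hA.eigenvectorBasis.orthonormal j i
    rw [EuclideanSpace.inner_eq_star_dotProduct] at this
    simpa [hv, eq_comm] using this
  have hAv : ∀ i, A *ᵥ v i = hA.eigenvalues i • v i := fun i => hA.mulVec_eigenvectorBasis i
  refine ⟨hA, Set.ncard_eq_one.2 ?_⟩
  obtain ⟨i, hi⟩ : ∃ i, hA.eigenvalues i < 0 := by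
    by_contra hcon
    push Not at hcon
    exact hneg (hA.posSemidef_iff_eigenvalues_nonneg.2 hcon)
  refine ⟨i, Set.eq_singleton_iff_unique_mem.2 ⟨hi, fun j (hj : hA.eigenvalues j < 0) => ?_⟩⟩
  by_contra hji
  have h1 := hquad (v i)
  -- This combination is orthogonal to `w`.
  have h2 := hquad ((w ⬝ᵥ v j) • v i - (w ⬝ᵥ v i) • v j)
  simp only [hAv, Matrix.mulVec_sub, Matrix.mulVec_smul, dotProduct_sub, sub_dotProduct,
    dotProduct_smul, smul_dotProduct, smul_eq_mul, hvv, if_true, hji, Ne.symm hji, if_false]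
    at h1 h2
  set a := w ⬝ᵥ v i
  set b := w ⬝ᵥ v j
  have ha : 0 < a ^ 2 := by linarith
  nlinarith [mul_pos ha (neg_pos.2 hj), mul_nonneg (sq_nonneg b) (neg_pos.2 hi).le]

lemma IsDescribedBy.eq_zero_of_adj {X : Matrix (Fin n) (Fin n) ℝ} (hG : IsDescribedBy G A)
    (hX : Matrix.hadamard A X = 0) {u v : Fin n} (h : G.Adj u v) : X u v = 0 := by
  have h1 := congrFun (congrFun hX u) v
  rw [Matrix.hadamard_apply, Matrix.zero_apply, mul_eq_zero] at h1
  exact h1.resolve_left ((hG.2 u v h.ne).2 h)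

lemma diag_eq_zero_of_hadamard {X : Matrix (Fin n) (Fin n) ℝ}
    (hX : Matrix.hadamard (1 : Matrix (Fin n) (Fin n) ℝ) X = 0) (u : Fin n) : X u u = 0 := by
  simpa using congrFun (congrFun hX u) u

/-- If the kernel is supported on a clique, the Strong Arnold Property holds. -/
lemma strongArnold_of_kernel_clique (hG : IsDescribedBy G A) {P : Finset (Fin n)}
    (hP : ∀ u ∈ P, ∀ v ∈ P, u ≠ v → G.Adj u v)
    (hker : ∀ y : Fin n → ℝ, A *ᵥ y = 0 → ∀ u ∉ P, y u = 0) : StrongArnold A := by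
  intro X hX hAX hAX' hIX
  -- The columns of `X` lie in the kernel of `A`. By symmetry `X` is then supported on `P × P`,
  -- where every entry is diagonal or belongs to an edge.
  have h1 : ∀ u v, u ∉ P → X u v = 0 := by
    intro u v hu
    refine hker (fun w => X w v) ?_ u hu
    ext w
    exact congrFun (congrFun hAX w) v
  ext u v
  by_cases hu : u ∈ P
  · by_cases hv : v ∈ P
    · by_cases huv : u = v
      · subst huv; exact diag_eq_zero_of_hadamard hIX u
      · exact hG.eq_zero_of_adj hAX' (hP u hu v hv huv)
    · rw [← hX.apply u v]; exact h1 v u hv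
  · exact h1 u v hu

/-- The Strong Arnold Property of matrices with unit diagonal, for graphs whose nonisolated
vertices induce a complete bipartite graph. -/
lemma strongArnold_of_diag_one (hG : IsDescribedBy G A) (hdiag : ∀ u, A u u = 1)
    (h : ∀ u w v, G.Adj u w → G.Adj w v ∨ G.Adj u v ∨ ∀ x, ¬ G.Adj v x) :
    StrongArnold A := by
  intro X hX hAX hAX' hIX
  -- Row `u` of `A * X = 0` expresses `X u v` through the entries `X w v` at the neighbours `w` of
  -- `u`.
  have key : ∀ u v, (∀ w, G.Adj u w → X w v = 0) → X u v = 0 := by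
    intro u v huv
    have h1 := congrFun (congrFun hAX u) v
    rw [Matrix.mul_apply, Finset.sum_eq_single u, hdiag, one_mul] at h1
    · exact h1
    · intro w _ hwu
      by_cases hw : G.Adj u w
      · rw [huv w hw, mul_zero]
      · rw [not_not.1 fun h' => hw ((hG.2 u w hwu.symm).1 h'), zero_mul]
    · simp
  ext u v
  by_cases huv : G.Adj u v
  · exact hG.eq_zero_of_adj hAX' huv
  by_cases hv : ∀ x, ¬ G.Adj v x
  · rw [← hX.apply u v]
    exact key v u fun w hw => absurd hw (hv w)
  · refine key u v fun w hw => ?_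
    rcases h u w v hw with h1 | h1 | h1
    · exact hG.eq_zero_of_adj hAX' h1
    · exact absurd h1 huv
    · exact absurd h1 hv

/-! ### The parameters as maxima -/

lemma le_cdvNu (hG : IsDescribedBy G A) (hA : StrongArnold A) (hpos : A.PosSemidef) :
    nullity A ≤ cdvNu n G :=
  le_csSup ⟨n, by rintro q ⟨A, -, -, -, rfl⟩; exact nullity_le A⟩ ⟨A, hG, hA, hpos, rfl⟩

lemma le_cdvMu (hG : IsDescribedBy G A) (hA : StrongArnold A) (hneg : HasOneNegEigenvalue A)
    (hoff : ∀ i j : Fin n, i ≠ j → A i j ≤ 0) : nullity A ≤ cdvMu n G :=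
  le_csSup ⟨n, by rintro q ⟨A, -, -, -, -, rfl⟩; exact nullity_le A⟩ ⟨A, hG, hA, hneg, hoff, rfl⟩

lemma bddAbove_cdvXi (G : SimpleGraph (Fin n)) : BddAbove {q : ℕ |
    ∃ A : Matrix (Fin n) (Fin n) ℝ, IsDescribedBy G A ∧ StrongArnold A ∧ q = nullity A} :=
  ⟨n, by rintro q ⟨A, -, -, rfl⟩; exact nullity_le A⟩

lemma cdvNu_le_cdvXi (G : SimpleGraph (Fin n)) : cdvNu n G ≤ cdvXi n G := by
  refine csSup_le' ?_
  rintro q ⟨A, h1, h2, -, rfl⟩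
  exact le_csSup (bddAbove_cdvXi G) ⟨A, h1, h2, rfl⟩

lemma cdvMu_le_cdvXi (G : SimpleGraph (Fin n)) : cdvMu n G ≤ cdvXi n G := by
  refine csSup_le' ?_
  rintro q ⟨A, h1, h2, -, -, rfl⟩
  exact le_csSup (bddAbove_cdvXi G) ⟨A, h1, h2, rfl⟩

open Classical in
lemma cdvXi_sq_le (G : SimpleGraph (Fin n)) :
    cdvXi n G ^ 2 ≤ 2 * n + 2 * G.edgeFinset.card := by
  rcases Set.eq_empty_or_nonempty {q : ℕ | ∃ A : Matrix (Fin n) (Fin n) ℝ,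
    IsDescribedBy G A ∧ StrongArnold A ∧ q = nullity A} with h | h
  · have : cdvXi n G = 0 := by rw [cdvXi, h, csSup_empty]; rfl
    simp [this]
  · obtain ⟨A, h1, h2, h3⟩ := Nat.sSup_mem h (bddAbove_cdvXi G)
    have h4 := h2.choose_nullity_le h1
    have h5 : cdvXi n G = nullity A := h3
    rw [h5]
    have h6 := two_mul_choose_two (nullity A)
    nlinarith

end Matrix
/-! ### Graphs with a clique component -/

section Clique

open Matrix

variable {n : ℕ} {G : SimpleGraph (Fin n)} {P : Finset (Fin n)}

/-- The part of `G` outside of `P`. -/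
def outside (G : SimpleGraph (Fin n)) (P : Finset (Fin n)) : SimpleGraph (Fin n) where
  Adj u v := G.Adj u v ∧ u ∉ P ∧ v ∉ P
  symm := ⟨fun _ _ h => ⟨h.1.symm, h.2.2, h.2.1⟩⟩
  loopless := ⟨fun _ h => h.1.ne rfl⟩

/-- The indicator vector of `P`. -/
def indicatorVec (P : Finset (Fin n)) : Fin n → ℝ := fun u => if u ∈ P then 1 else 0

open Classical in
/-- A positive semidefinite matrix for the part of `G` outside of `P`, which is definite there. -/
noncomputable def outsideMatrix (G : SimpleGraph (Fin n)) (P : Finset (Fin n)) :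
    Matrix (Fin n) (Fin n) ℝ :=
  (outside G P).lapMatrix ℝ + diagonal (indicatorVec Pᶜ)

lemma outsideMatrix_apply_ne {u v : Fin n} (h : u ≠ v) [Decidable (G.Adj u v ∧ u ∉ P ∧ v ∉ P)] :
    outsideMatrix G P u v = if G.Adj u v ∧ u ∉ P ∧ v ∉ P then -1 else 0 := by
  classical
  simp only [outsideMatrix, SimpleGraph.lapMatrix, SimpleGraph.degMatrix, Matrix.add_apply,
    Matrix.sub_apply, Matrix.diagonal_apply_ne _ h, SimpleGraph.adjMatrix_apply]
  split_ifs with h1 h2 h2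
  · simp
  · exact absurd h1 h2
  · exact absurd h2 h1
  · simp

lemma outsideMatrix_apply_self {u : Fin n} (hu : u ∈ P) : outsideMatrix G P u u = 0 := by
  classical
  have h0 : (outside G P).degree u = 0 := by
    rw [SimpleGraph.degree_eq_zero_iff_notMem_support]
    rintro ⟨v, hv⟩
    exact hv.2.1 hu
  simp [outsideMatrix, SimpleGraph.lapMatrix, SimpleGraph.degMatrix, indicatorVec, hu, h0]

lemma outsideMatrix_apply_mem {u : Fin n} (hu : u ∈ P) (v : Fin n) :
    outsideMatrix G P u v = 0 := by
  classical
  by_cases h : u = v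
  · subst h; exact outsideMatrix_apply_self hu
  · rw [outsideMatrix_apply_ne h, if_neg (by simp [hu])]

lemma outsideMatrix_isSymm : (outsideMatrix G P).IsSymm := by
  classical
  exact ((outside G P).isSymm_lapMatrix (R := ℝ)).add (isSymm_diagonal _)

lemma outsideMatrix_posSemidef : (outsideMatrix G P).PosSemidef := by
  classical
  refine ((outside G P).posSemidef_lapMatrix ℝ).add (PosSemidef.diagonal fun u => ?_)
  simp only [indicatorVec, Pi.zero_apply]
  split_ifs <;> norm_num

/-- The quadratic form is a nonnegative Laplacian form plus the sum of `y v ^ 2` over `v ∉ P`. -/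
lemma outsideMatrix_kernel {y : Fin n → ℝ} (hy : outsideMatrix G P *ᵥ y = 0) {u : Fin n}
    (hu : u ∉ P) : y u = 0 := by
  classical
  have h1 : y ⬝ᵥ outsideMatrix G P *ᵥ y = 0 := by rw [hy, dotProduct_zero]
  rw [outsideMatrix, Matrix.add_mulVec, dotProduct_add] at h1
  have h2 := ((outside G P).posSemidef_lapMatrix ℝ).dotProduct_mulVec_nonneg y
  rw [star_trivial] at h2
  have h3 : y ⬝ᵥ diagonal (indicatorVec Pᶜ) *ᵥ y = ∑ v, if v ∈ P then 0 else y v ^ 2 := by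
    rw [dotProduct]
    refine Finset.sum_congr rfl fun v _ => ?_
    rw [mulVec_diagonal, indicatorVec]
    by_cases hv : v ∈ P
    · simp [hv]
    · simp [hv, sq]
  have hnn : ∀ v ∈ (Finset.univ : Finset (Fin n)), 0 ≤ if v ∈ P then 0 else y v ^ 2 := by
    intro v _
    split_ifs
    · exact le_rfl
    · exact sq_nonneg _
  have h4 := Finset.sum_nonneg hnn
  have h5 : ∑ v, (if v ∈ P then 0 else y v ^ 2) = 0 := by linarith
  have h6 := (Finset.sum_eq_zero_iff_of_nonneg hnn).1 h5 u (Finset.mem_univ _)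
  rw [if_neg hu] at h6
  exact pow_eq_zero_iff two_ne_zero |>.1 h6

/-- The matrix with entries `σ` on `P × P`, combined with `outsideMatrix G P`. -/
noncomputable def cliqueMatrix (G : SimpleGraph (Fin n)) (P : Finset (Fin n)) (σ : ℝ) :
    Matrix (Fin n) (Fin n) ℝ :=
  outsideMatrix G P + σ • vecMulVec (indicatorVec P) (indicatorVec P)

lemma cliqueMatrix_mulVec (σ : ℝ) (y : Fin n → ℝ) : cliqueMatrix G P σ *ᵥ y =
    outsideMatrix G P *ᵥ y + (σ * (indicatorVec P ⬝ᵥ y)) • indicatorVec P := by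
  rw [cliqueMatrix, Matrix.add_mulVec, Matrix.smul_mulVec, vecMulVec_mulVec, op_smul_eq_smul,
    smul_smul]

lemma cliqueMatrix_isSymm (σ : ℝ) : (cliqueMatrix G P σ).IsSymm := by
  refine outsideMatrix_isSymm.add ?_
  rw [Matrix.IsSymm, Matrix.transpose_smul, Matrix.transpose_vecMulVec]

variable {σ : ℝ}

lemma cliqueMatrix_apply (u v : Fin n) : cliqueMatrix G P σ u v =
    outsideMatrix G P u v + if u ∈ P ∧ v ∈ P then σ else 0 := by
  simp only [cliqueMatrix, Matrix.add_apply, Matrix.smul_apply, vecMulVec_apply, indicatorVec]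
  by_cases hu : u ∈ P <;> by_cases hv : v ∈ P <;> simp [hu, hv]

lemma isDescribedBy_cliqueMatrix (hP : ∀ u ∈ P, ∀ v, G.Adj u v ↔ v ∈ P ∧ u ≠ v)
    (hσ : σ ≠ 0) : IsDescribedBy G (cliqueMatrix G P σ) := by
  classical
  refine ⟨cliqueMatrix_isSymm σ, fun u v h => ?_⟩
  rw [cliqueMatrix_apply, outsideMatrix_apply_ne h]
  by_cases hu : u ∈ P
  · simp [hu, hP u hu, h, hσ]
  · by_cases hv : v ∈ P
    · simp [hu, hv, G.adj_comm u v, hP v hv]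
    · simp [hu, hv]

/-- A row indexed by `P` says that the entries of `y` on `P` sum to zero. The rank-one term then
drops out, leaving the kernel of `outsideMatrix`. -/
lemma cliqueMatrix_kernel (hσ : σ ≠ 0) (hne : P.Nonempty) {y : Fin n → ℝ}
    (hy : cliqueMatrix G P σ *ᵥ y = 0) {u : Fin n} (hu : u ∉ P) : y u = 0 := by
  rw [cliqueMatrix_mulVec] at hy
  obtain ⟨a, ha⟩ := hne
  have h1 : (outsideMatrix G P *ᵥ y) a = 0 := by
    rw [Matrix.mulVec, dotProduct]
    exact Finset.sum_eq_zero fun v _ => by rw [outsideMatrix_apply_mem ha, zero_mul]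
  have h2 := congrFun hy a
  simp only [Pi.add_apply, h1, Pi.smul_apply, indicatorVec, ha, if_true, smul_eq_mul, mul_one,
    zero_add, Pi.zero_apply, mul_eq_zero, hσ, false_or] at h2
  refine outsideMatrix_kernel (P := P) (G := G) ?_ hu
  have h3 : indicatorVec P ⬝ᵥ y = 0 := h2
  rwa [h3, mul_zero, zero_smul, add_zero] at hy

lemma strongArnold_cliqueMatrix (hP : ∀ u ∈ P, ∀ v, G.Adj u v ↔ v ∈ P ∧ u ≠ v)
    (hσ : σ ≠ 0) (hne : P.Nonempty) :
    StrongArnold (cliqueMatrix G P σ) :=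
  strongArnold_of_kernel_clique (isDescribedBy_cliqueMatrix hP hσ)
    (fun u hu v hv huv => (hP u hu v).2 ⟨hv, huv⟩)
    fun _ hy _ hu => cliqueMatrix_kernel hσ hne hy hu

lemma dotProduct_indicatorVec_single (u : Fin n) :
    indicatorVec P ⬝ᵥ Pi.single u 1 = if u ∈ P then 1 else 0 := by
  simp [indicatorVec]

/-- Differences of unit vectors at points of `P` are in the kernel. -/
lemma card_le_nullity_cliqueMatrix : P.card ≤ nullity (cliqueMatrix G P σ) + 1 := by
  classical
  rcases P.eq_empty_or_nonempty with rfl | ⟨a, ha⟩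
  · simp
  have h := card_le_nullity (A := cliqueMatrix G P σ) (ι := P.erase a)
    (fun s => Pi.single s.1 1 - Pi.single a 1) (fun s => s.1) ?_ ?_
  · rw [Fintype.card_coe, Finset.card_erase_of_mem ha] at h
    omega
  · rintro ⟨s, hs⟩ ⟨t, ht⟩
    have hta : t ≠ a := (Finset.mem_erase.1 ht).1
    simp [Pi.single_apply, hta, Subtype.ext_iff, eq_comm]
  · rintro ⟨s, hs⟩
    have hsP : s ∈ P := (Finset.mem_erase.1 hs).2
    have hcol : ∀ t ∈ P, outsideMatrix G P *ᵥ Pi.single t 1 = 0 := by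
      intro t ht
      ext v
      rw [Matrix.mulVec_single_one, Matrix.col_apply, ← outsideMatrix_isSymm.apply,
        outsideMatrix_apply_mem ht, Pi.zero_apply]
    rw [cliqueMatrix_mulVec, Matrix.mulVec_sub, hcol s hsP, hcol a ha, dotProduct_sub,
      dotProduct_indicatorVec_single, dotProduct_indicatorVec_single, if_pos hsP, if_pos ha]
    simp

lemma posSemidef_vecMulVec_self (w : Fin n → ℝ) : (vecMulVec w w).PosSemidef := by
  simpa using posSemidef_vecMulVec_self_star w

lemma card_le_cdvNu_of_clique (hP : ∀ u ∈ P, ∀ v, G.Adj u v ↔ v ∈ P ∧ u ≠ v)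
    (hne : P.Nonempty) : P.card ≤ cdvNu n G + 1 := by
  refine card_le_nullity_cliqueMatrix.trans (Nat.add_le_add_right (le_cdvNu
    (isDescribedBy_cliqueMatrix hP one_ne_zero) (strongArnold_cliqueMatrix hP one_ne_zero hne) ?_) 1)
  rw [cliqueMatrix, one_smul]
  exact outsideMatrix_posSemidef.add (posSemidef_vecMulVec_self _)

/-- With `σ = -1` the off-diagonal entries are nonpositive. Adding back the rank-one term leaves a
positive semidefinite matrix, while a diagonal entry `-1` rules out semidefiniteness before that. -/
lemma card_le_cdvMu_of_clique (hP : ∀ u ∈ P, ∀ v, G.Adj u v ↔ v ∈ P ∧ u ≠ v)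
    (hne : P.Nonempty) : P.card ≤ cdvMu n G + 1 := by
  classical
  have h0 : (-1 : ℝ) ≠ 0 := by norm_num
  refine card_le_nullity_cliqueMatrix.trans (Nat.add_le_add_right (le_cdvMu
    (isDescribedBy_cliqueMatrix hP h0) (strongArnold_cliqueMatrix hP h0 hne) ?_ ?_) 1)
  · refine hasOneNegEigenvalue_of_posSemidef (w := indicatorVec P)
      ((conjTranspose_eq_transpose_of_trivial _).trans (cliqueMatrix_isSymm _)) ?_ ?_
    · rw [cliqueMatrix, neg_one_smul, neg_add_cancel_right]
      exact outsideMatrix_posSemidef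
    · intro h
      obtain ⟨a, ha⟩ := hne
      have h1 := h.diag_nonneg (i := a)
      simp only [cliqueMatrix, Matrix.add_apply, outsideMatrix_apply_self ha, Matrix.smul_apply,
        vecMulVec_apply, indicatorVec, ha, if_true] at h1
      norm_num at h1
  · intro u v h
    rw [cliqueMatrix_apply, outsideMatrix_apply_ne h]
    split_ifs <;> norm_num

end Clique

/-! ### Complete bipartite graphs with isolated vertices -/

section Bipartite

open Matrix

variable {n : ℕ} {P Q : Finset (Fin n)}

/-- The complete bipartite graph between `P` and `Q`; the other vertices are isolated. -/
def IsCompleteBetween (G : SimpleGraph (Fin n)) (P Q : Finset (Fin n)) : Prop :=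
  ∀ u v, G.Adj u v ↔ (u ∈ P ∧ v ∈ Q) ∨ (v ∈ P ∧ u ∈ Q)

variable {G : SimpleGraph (Fin n)} {T : Matrix (Fin n) (Fin n) ℝ}

lemma strongArnold_one_add {A : Matrix (Fin n) (Fin n) ℝ} (hG : IsCompleteBetween G P Q)
    (hA : IsDescribedBy G A) (hdiag : ∀ u, A u u = 1) : StrongArnold A := by
  refine strongArnold_of_diag_one hA hdiag fun u w v => ?_
  simp only [hG _ _]
  by_cases h1 : v ∈ P <;> by_cases h2 : v ∈ Q <;> simp only [h1, h2] <;> tauto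

lemma isDescribedBy_one_add (hG : IsCompleteBetween G P Q) (hPQ : Disjoint P Q)
    (hT : ∀ u v, T u v ≠ 0 ↔ u ∈ P ∧ v ∈ Q) : IsDescribedBy G (1 + T + Tᵀ) := by
  refine ⟨?_, fun u v huv => ?_⟩
  · rw [Matrix.IsSymm, Matrix.transpose_add, Matrix.transpose_add, Matrix.transpose_transpose,
      Matrix.transpose_one, add_right_comm]
  · rw [hG, ← hT, ← hT]
    simp only [Matrix.add_apply, Matrix.one_apply_ne huv, zero_add, Matrix.transpose_apply]
    by_cases h1 : T u v = 0
    · simp [h1]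
    · have h2 : T v u = 0 := by
        by_contra h2
        exact Finset.disjoint_left.1 hPQ ((hT u v).1 h1).1 ((hT v u).1 h2).2
      simp [h1, h2]

/-- `T` has orthonormal rows, indexed by `P`, and columns indexed by the complement of `P`. -/
structure IsCoisometry (P : Finset (Fin n)) (T : Matrix (Fin n) (Fin n) ℝ) : Prop where
  mul_transpose : T * Tᵀ = diagonal (indicatorVec P)
  diag_mul : diagonal (indicatorVec P) * T = T
  mul_diag : T * diagonal (indicatorVec P) = 0

lemma IsCoisometry.neg (h : IsCoisometry P T) : IsCoisometry P (-T) where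
  mul_transpose := by simp [h.mul_transpose]
  diag_mul := by simp [h.diag_mul]
  mul_diag := by simp [h.mul_diag]

lemma diagonal_indicatorVec_mul_self :
    (diagonal (indicatorVec P) : Matrix (Fin n) (Fin n) ℝ) * diagonal (indicatorVec P) =
      diagonal (indicatorVec P) := by
  rw [diagonal_mul_diagonal]
  congr 1
  ext u
  simp [indicatorVec]

lemma IsCoisometry.diag_mul_transpose (h : IsCoisometry P T) :
    diagonal (indicatorVec P) * Tᵀ = 0 := by
  rw [← diagonal_transpose, ← Matrix.transpose_mul, h.mul_diag, Matrix.transpose_zero]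

lemma IsCoisometry.transpose_mul_diag (h : IsCoisometry P T) :
    Tᵀ * diagonal (indicatorVec P) = Tᵀ := by
  rw [← diagonal_transpose, ← Matrix.transpose_mul, h.diag_mul]

/-- In blocks for `P` and its complement the matrix is `[[I, T], [Tᵀ, I]]`, the Gram matrix of the
rows of `[T; I]` because `T Tᵀ = I`. Its kernel consists of the vectors `(x, -Tᵀ x)`, which gives
nullity `|P|`. -/
lemma IsCoisometry.posSemidef (h : IsCoisometry P T) : (1 + T + Tᵀ).PosSemidef := by
  have h1 : 1 + T + Tᵀ = (1 - diagonal (indicatorVec P) + T) *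
      (1 - diagonal (indicatorVec P) + T)ᴴ := by
    rw [conjTranspose_eq_transpose_of_trivial, Matrix.transpose_add, Matrix.transpose_sub,
      Matrix.transpose_one, diagonal_transpose]
    simp only [Matrix.add_mul, Matrix.mul_add, Matrix.sub_mul, Matrix.mul_sub, Matrix.one_mul,
      Matrix.mul_one, h.mul_transpose, h.mul_diag, h.diag_mul_transpose,
      diagonal_indicatorVec_mul_self]
    abel
  rw [h1]
  exact posSemidef_self_mul_conjTranspose _

lemma IsCoisometry.mul_kernel (h : IsCoisometry P T) :
    (1 + T + Tᵀ) * (diagonal (indicatorVec P) - Tᵀ) = 0 := by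
  have hTT : T * T = 0 := by
    calc T * T = T * (diagonal (indicatorVec P) * T) := by rw [h.diag_mul]
      _ = 0 := by rw [← Matrix.mul_assoc, h.mul_diag, Matrix.zero_mul]
  have hTT' : Tᵀ * Tᵀ = 0 := by rw [← Matrix.transpose_mul, hTT, Matrix.transpose_zero]
  simp only [Matrix.add_mul, Matrix.mul_sub, Matrix.one_mul, h.mul_transpose, h.mul_diag,
    h.transpose_mul_diag, hTT']
  abel

/-! ### Explicit coisometries and the resulting bounds for `ν` and `μ`. -/

/-- The matrix of an injection `φ` on `P`. -/
def injMatrix (P : Finset (Fin n)) (φ : Fin n → Fin n) : Matrix (Fin n) (Fin n) ℝ :=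
  Matrix.of fun u v => if u ∈ P ∧ φ u = v then 1 else 0

/-- Rows of the reflection `1 - (2 / |Q|) J` on `Q`, selected by `φ`. -/
noncomputable def reflMatrix (P Q : Finset (Fin n)) (φ : Fin n → Fin n) :
    Matrix (Fin n) (Fin n) ℝ :=
  Matrix.of fun u v => if u ∈ P ∧ v ∈ Q then (if φ u = v then 1 else 0) - 2 / (Q.card : ℝ) else 0

variable {φ : Fin n → Fin n}

lemma isCoisometry_of_support (hPQ : Disjoint P Q) (hT : ∀ u v, T u v ≠ 0 → u ∈ P ∧ v ∈ Q)
    (h : ∀ u ∈ P, ∀ v ∈ P, ∑ w ∈ Q, T u w * T v w = if u = v then 1 else 0) :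
    IsCoisometry P T where
  mul_transpose := by
    ext u v
    rw [Matrix.mul_apply, diagonal_apply]
    simp only [Matrix.transpose_apply, indicatorVec]
    by_cases huv : u ∈ P ∧ v ∈ P
    · rw [← Finset.sum_subset (Finset.subset_univ Q), h u huv.1 v huv.2, if_pos huv.1]
      intro w _ hw
      rw [not_not.1 fun h' => hw (hT u w h').2, zero_mul]
    · have : (if u = v then (if u ∈ P then (1 : ℝ) else 0) else 0) = 0 := by
        split_ifs with h1 h2
        · exact absurd ⟨h2, h1 ▸ h2⟩ huv
        · rfl
        · rfl
      rw [this]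
      refine Finset.sum_eq_zero fun w _ => ?_
      by_contra hcon
      exact huv ⟨(hT u w (left_ne_zero_of_mul hcon)).1, (hT v w (right_ne_zero_of_mul hcon)).1⟩
  diag_mul := by
    ext u v
    rw [diagonal_mul, indicatorVec]
    split_ifs with hu
    · rw [one_mul]
    · rw [zero_mul, not_not.1 fun h' => hu (hT u v h').1]
  mul_diag := by
    ext u v
    rw [mul_diagonal, indicatorVec]
    split_ifs with hv
    · rw [not_not.1 fun h' => Finset.disjoint_left.1 hPQ hv (hT u v h').2, zero_mul]; rfl
    · rw [mul_zero]; rfl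

lemma isCoisometry_injMatrix (hPQ : Disjoint P Q) (hφ : Set.InjOn φ P) (hφQ : ∀ u ∈ P, φ u ∈ Q) :
    IsCoisometry P (injMatrix P φ) := by
  refine isCoisometry_of_support hPQ (Q := Q) (fun u v h => ?_) fun u hu v hv => ?_
  · simp only [injMatrix, of_apply, ne_eq, ite_eq_right_iff, one_ne_zero, imp_false,
      not_not] at h
    exact ⟨h.1, h.2 ▸ hφQ u h.1⟩
  · simp only [injMatrix, of_apply, hu, hv, true_and]
    rw [Finset.sum_eq_single (φ u)]
    · by_cases huv : u = v
      · simp [huv]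
      · have : φ v ≠ φ u := fun h => huv (hφ hu hv h.symm)
        simp [huv, this]
    · intro w _ hw
      rw [if_neg hw.symm, zero_mul]
    · exact fun h => absurd (hφQ u hu) h

lemma isCoisometry_reflMatrix (hPQ : Disjoint P Q) (hφ : Set.InjOn φ P)
    (hφQ : ∀ u ∈ P, φ u ∈ Q) : IsCoisometry P (reflMatrix P Q φ) := by
  refine isCoisometry_of_support hPQ (Q := Q) (fun u v h => ?_) fun u hu v hv => ?_
  · by_contra hcon
    exact h (by rw [reflMatrix, of_apply, if_neg hcon])
  · have hq : (Q.card : ℝ) ≠ 0 := by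
      have := Finset.card_pos.2 ⟨_, hφQ u hu⟩
      positivity
    -- Summed over `Q`, the two linear terms contribute `-4 / |Q|`, which cancels the sum of the
    -- constants `4 / |Q| ^ 2`.
    have h1 : ∀ w ∈ Q, reflMatrix P Q φ u w * reflMatrix P Q φ v w =
        (if φ u = w then (if φ v = w then 1 else 0) else 0) -
          2 / (Q.card : ℝ) * (if φ u = w then 1 else 0) -
          2 / (Q.card : ℝ) * (if φ v = w then 1 else 0) + 4 / (Q.card : ℝ) ^ 2 := by
      intro w hw
      simp only [reflMatrix, of_apply, hu, hv, hw, and_self, if_true]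
      split_ifs <;> ring
    rw [Finset.sum_congr rfl h1, Finset.sum_add_distrib, Finset.sum_sub_distrib,
      Finset.sum_sub_distrib, ← Finset.mul_sum, ← Finset.mul_sum, Finset.sum_ite_eq,
      Finset.sum_ite_eq, Finset.sum_ite_eq, if_pos (hφQ u hu), if_pos (hφQ v hv),
      Finset.sum_const, nsmul_eq_mul]
    have h2 : (φ v = φ u) ↔ u = v := ⟨fun h => hφ hu hv h.symm, fun h => by rw [h]⟩
    simp only [h2, if_pos (hφQ u hu)]
    field_simp
    ring

/-- Every entry of `T` on `P × Q` must be nonzero. The reflection has entries `1 - 2 / |Q|` and `-2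
/ |Q|`, so `|Q| ≥ 3` suffices, whereas `1 - 2 / |Q|` vanishes for `|Q| = 2`. -/
lemma card_le_cdvNu_of_complete_bipartite (hG : IsCompleteBetween G P Q) (hPQ : Disjoint P Q)
    (hφ : Set.InjOn φ P) (hφQ : ∀ u ∈ P, φ u ∈ Q) (hQ : 3 ≤ Q.card) :
    P.card ≤ cdvNu n G := by
  classical
  set T := reflMatrix P Q φ with hTdef
  have hT : IsCoisometry P T := isCoisometry_reflMatrix hPQ hφ hφQ
  have hTne : ∀ u v, T u v ≠ 0 ↔ u ∈ P ∧ v ∈ Q := by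
    intro u v
    rw [hTdef, reflMatrix, of_apply]
    have hq : (3 : ℝ) ≤ Q.card := by exact_mod_cast hQ
    have h1 : (1 : ℝ) - 2 / Q.card ≠ 0 := by
      have : 2 / (Q.card : ℝ) < 1 := by rw [div_lt_one] <;> linarith
      linarith
    have h2 : (0 : ℝ) - 2 / Q.card ≠ 0 := by
      have : 0 < 2 / (Q.card : ℝ) := by positivity
      linarith
    split_ifs with h3 h4
    · simpa [h3] using h1
    · simpa [h3] using h2
    · simp [h3]
  have hTdiag : ∀ u, T u u = 0 := fun u =>
    not_not.1 fun h => Finset.disjoint_left.1 hPQ ((hTne u u).1 h).1 ((hTne u u).1 h).2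
  have hA := isDescribedBy_one_add hG hPQ hTne
  refine le_trans ?_ (le_cdvNu hA (strongArnold_one_add hG hA fun u => by simp [hTdiag])
    hT.posSemidef)
  have h := card_le_nullity (A := 1 + T + Tᵀ) (ι := P)
    (fun s => (diagonal (indicatorVec P) - Tᵀ) *ᵥ Pi.single s.1 1) (fun s => s.1) ?_ ?_
  · rwa [Fintype.card_coe] at h
  · rintro ⟨s, hs⟩ ⟨t, ht⟩
    have h0 : T s t = 0 := not_not.1 fun h => Finset.disjoint_left.1 hPQ ht ((hTne s t).1 h).2
    simp [diagonal_apply, indicatorVec, h0, ht, eq_comm]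
  · intro s
    rw [Matrix.mulVec_mulVec, hT.mul_kernel, Matrix.zero_mulVec]

/-- Subtracting the all-ones block `J` from `-F` makes every entry on `P × Q` equal to `-1` or `-2`.
The kernel vectors `e_t + e_{φ t}` for `-F` all have the same sums over `P` and over `Q`, so their
differences remain in the kernel, and only one dimension is lost. -/
lemma card_le_cdvMu_of_complete_bipartite (hG : IsCompleteBetween G P Q) (hPQ : Disjoint P Q)
    (hφ : Set.InjOn φ P) (hφQ : ∀ u ∈ P, φ u ∈ Q) (hP : P.Nonempty) :
    P.card ≤ cdvMu n G + 1 := by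
  classical
  obtain ⟨a, ha⟩ := hP
  set F := injMatrix P φ with hFdef
  have hF : IsCoisometry P (-F) := (isCoisometry_injMatrix hPQ hφ hφQ).neg
  set J := vecMulVec (indicatorVec P) (indicatorVec Q) with hJ
  set T := -F - J with hTdef
  have hTapply : ∀ u v, T u v = if u ∈ P ∧ v ∈ Q then -(if φ u = v then 1 else 0) - 1 else 0 := by
    intro u v
    simp only [hTdef, hFdef, hJ, injMatrix, Matrix.sub_apply, Matrix.neg_apply, of_apply,
      vecMulVec_apply, indicatorVec]
    by_cases hu : u ∈ P
    · by_cases hv : v ∈ Q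
      · simp [hu, hv]
      · have : φ u ≠ v := fun h => hv (h ▸ hφQ u hu)
        simp [hu, hv, this]
    · simp [hu]
  have hTne : ∀ u v, T u v ≠ 0 ↔ u ∈ P ∧ v ∈ Q := by
    intro u v
    rw [hTapply]
    split_ifs with h3 h4
    · simp only [h3, and_self, iff_true]; norm_num
    · simp only [h3, and_self, iff_true]; norm_num
    · simp [h3]
  have hTnonpos : ∀ u v, T u v ≤ 0 := by
    intro u v
    rw [hTapply]
    split_ifs <;> norm_num
  have hTdiag : ∀ u, T u u = 0 := fun u =>
    not_not.1 fun h => Finset.disjoint_left.1 hPQ ((hTne u u).1 h).1 ((hTne u u).1 h).2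
  have hA := isDescribedBy_one_add hG hPQ hTne
  have haQ := hφQ a ha
  have hdec : 1 + T + Tᵀ = (1 + -F + (-F)ᵀ) - J - Jᵀ := by
    rw [hTdef, Matrix.transpose_sub]
    abel
  refine le_trans ?_ (Nat.add_le_add_right (le_cdvMu hA
    (strongArnold_one_add hG hA fun u => by simp [hTdiag]) ?_ ?_) 1)
  · have h := card_le_nullity (A := 1 + T + Tᵀ) (ι := P.erase a)
      (fun s => (diagonal (indicatorVec P) - (-F)ᵀ) *ᵥ (Pi.single s.1 1 - Pi.single a 1))
      (fun s => s.1) ?_ ?_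
    · rw [Fintype.card_coe, Finset.card_erase_of_mem ha] at h
      omega
    · rintro ⟨s, hs⟩ ⟨t, ht⟩
      obtain ⟨hta, htP⟩ := Finset.mem_erase.1 ht
      have h0 : ∀ u, F u t = 0 := by
        intro u
        simp only [hFdef, injMatrix, of_apply]
        refine if_neg ?_
        rintro ⟨h1, rfl⟩
        exact Finset.disjoint_left.1 hPQ htP (hφQ u h1)
      simp [Matrix.mulVec_sub, diagonal_apply, indicatorVec, h0, htP, hta, eq_comm]
    · rintro ⟨s, hs⟩
      have hsP : s ∈ P := (Finset.mem_erase.1 hs).2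
      have hK : ∀ t ∈ P, (diagonal (indicatorVec P) - (-F)ᵀ) *ᵥ Pi.single t 1 =
          Pi.single t 1 + Pi.single (φ t) 1 := by
        intro t ht
        ext v
        simp only [Matrix.mulVec_single_one, Matrix.col_apply, Matrix.sub_apply,
          Matrix.transpose_apply, Matrix.neg_apply, sub_neg_eq_add, Pi.add_apply, hFdef,
          injMatrix, of_apply, ht, true_and, Pi.single_apply, eq_comm (a := v)]
        congr 1
        by_cases htv : t = v
        · subst htv; simp [indicatorVec, ht]
        · simp [htv, Ne.symm htv]
      have hp : ∀ t ∈ P, indicatorVec P ⬝ᵥ ((diagonal (indicatorVec P) - (-F)ᵀ) *ᵥ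
          Pi.single t 1) = 1 := by
        intro t ht
        rw [hK t ht, dotProduct_add, dotProduct_indicatorVec_single,
          dotProduct_indicatorVec_single, if_pos ht,
          if_neg fun h => Finset.disjoint_left.1 hPQ h (hφQ t ht), add_zero]
      have hq : ∀ t ∈ P, indicatorVec Q ⬝ᵥ ((diagonal (indicatorVec P) - (-F)ᵀ) *ᵥ
          Pi.single t 1) = 1 := by
        intro t ht
        rw [hK t ht, dotProduct_add, dotProduct_indicatorVec_single,
          dotProduct_indicatorVec_single, if_pos (hφQ t ht),
          if_neg fun h => Finset.disjoint_left.1 hPQ ht h, zero_add]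
      rw [hdec, Matrix.sub_mulVec, Matrix.sub_mulVec, Matrix.mulVec_mulVec, hF.mul_kernel,
        Matrix.zero_mulVec, hJ, transpose_vecMulVec, vecMulVec_mulVec, vecMulVec_mulVec,
        Matrix.mulVec_sub, dotProduct_sub, dotProduct_sub, hp s hsP, hp a ha, hq s hsP, hq a ha]
      simp
  -- The square of `1_P + 1_Q` cancels `-J - Jᵀ` and leaves two positive semidefinite rank-one
  -- terms. Conversely, the form takes the value `1 + 1 - 4 < 0` at `e_a + e_{φ a}`.
  · refine hasOneNegEigenvalue_of_posSemidef (w := indicatorVec P + indicatorVec Q)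
      ((conjTranspose_eq_transpose_of_trivial _).trans hA.1) ?_ ?_
    · have h2 : 1 + T + Tᵀ + vecMulVec (indicatorVec P + indicatorVec Q)
          (indicatorVec P + indicatorVec Q) = (1 + -F + (-F)ᵀ) +
          vecMulVec (indicatorVec P) (indicatorVec P) +
          vecMulVec (indicatorVec Q) (indicatorVec Q) := by
        rw [hdec, hJ, transpose_vecMulVec, add_vecMulVec, vecMulVec_add, vecMulVec_add]
        abel
      rw [h2]
      exact (hF.posSemidef.add (posSemidef_vecMulVec_self _)).add (posSemidef_vecMulVec_self _)
    · intro h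
      have h1 := h.dotProduct_mulVec_nonneg (Pi.single a 1 + Pi.single (φ a) 1)
      have hne : a ≠ φ a := fun h => Finset.disjoint_left.1 hPQ ha (h ▸ haQ)
      have e1 : T a (φ a) = -2 := by rw [hTapply, if_pos ⟨ha, haQ⟩, if_pos rfl]; norm_num
      have e2 : T (φ a) a = 0 := by
        rw [hTapply, if_neg fun h => Finset.disjoint_left.1 hPQ h.1 haQ]
      simp [Matrix.mulVec_add, add_dotProduct, hTdiag, e1, e2, hne,
        hne.symm] at h1
      norm_num at h1
  · intro u v huv
    simp only [Matrix.add_apply, Matrix.one_apply_ne huv, zero_add, Matrix.transpose_apply]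
    exact add_nonpos (hTnonpos _ _) (hTnonpos _ _)

end Bipartite
/-! ### The Hadwiger number -/

section Hadwiger

variable {n k : ℕ} {G : SimpleGraph (Fin n)} {P Q : Finset (Fin n)} {φ : Fin n → Fin n}

lemma isMinor_top_le (h : IsMinor (⊤ : SimpleGraph (Fin k)) G) : k ≤ n := by
  obtain ⟨B, hB, hdisj, -⟩ := h
  have hne : ∀ a, ∃ u, u ∈ B a := fun a => by
    obtain ⟨u⟩ := (hB a).nonempty
    exact ⟨u.1, u.2⟩
  choose u hu using hne
  have hinj : Function.Injective u := by
    intro a b hab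
    by_contra hne
    exact Set.disjoint_left.1 (hdisj a b hne) (hu a) (hab ▸ hu b)
  simpa using Fintype.card_le_of_injective u hinj

lemma bddAbove_hadwiger (G : SimpleGraph (Fin n)) :
    BddAbove {k : ℕ | IsMinor (⊤ : SimpleGraph (Fin k)) G} := ⟨n, fun _ h => isMinor_top_le h⟩

lemma le_hadwiger (h : IsMinor (⊤ : SimpleGraph (Fin k)) G) : k ≤ hadwiger n G :=
  le_csSup (bddAbove_hadwiger G) h

-- Ordered pairs of distinct branch sets are at most as many as the darts, because a dart determines
-- the branch sets of its two ends.
open Classical in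
lemma IsMinor.mul_self_le (h : IsMinor (⊤ : SimpleGraph (Fin k)) G) :
    k * k ≤ k + 2 * G.edgeFinset.card := by
  obtain ⟨B, -, hdisj, hadj⟩ := h
  have hex : ∀ p : {p : Fin k × Fin k // p ∈ (Finset.univ : Finset (Fin k)).offDiag},
      ∃ d : G.Dart, d.fst ∈ B p.1.1 ∧ d.snd ∈ B p.1.2 := by
    rintro ⟨⟨a, b⟩, hab⟩
    obtain ⟨u, hu, v, hv, huv⟩ := hadj a b (Finset.mem_offDiag.1 hab).2.2
    exact ⟨⟨(u, v), huv⟩, hu, hv⟩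
  choose d hd1 hd2 using hex
  have hB : ∀ {a b u}, u ∈ B a → u ∈ B b → a = b := by
    intro a b u ha hb
    by_contra hne
    exact Set.disjoint_left.1 (hdisj a b hne) ha hb
  have hinj : Function.Injective d := by
    intro p q hpq
    exact Subtype.ext (Prod.ext (hB (hd1 p) (hpq ▸ hd1 q)) (hB (hd2 p) (hpq ▸ hd2 q)))
  have h1 := Fintype.card_le_of_injective d hinj
  rw [G.dart_card_eq_twice_card_edges, Fintype.card_coe, Finset.offDiag_card, Finset.card_univ,
    Fintype.card_fin] at h1
  omega

open Classical in
lemma hadwiger_sq_le (G : SimpleGraph (Fin n)) :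
    hadwiger n G ^ 2 ≤ 2 * n + 2 * G.edgeFinset.card := by
  rcases Set.eq_empty_or_nonempty {k : ℕ | IsMinor (⊤ : SimpleGraph (Fin k)) G} with h | h
  · have : hadwiger n G = 0 := by rw [hadwiger, h, csSup_empty]; rfl
    simp [this]
  · have h1 : IsMinor (⊤ : SimpleGraph (Fin (hadwiger n G))) G :=
      Nat.sSup_mem h (bddAbove_hadwiger G)
    have h2 := h1.mul_self_le
    have h3 := isMinor_top_le h1
    nlinarith

lemma card_le_hadwiger_of_clique (hP : ∀ u ∈ P, ∀ v, G.Adj u v ↔ v ∈ P ∧ u ≠ v) :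
    P.card ≤ hadwiger n G := by
  refine le_hadwiger ⟨fun a => {(P.equivFin.symm a).1}, fun a => ?_, fun a b hab => ?_,
    fun a b hab => ?_⟩
  · rw [SimpleGraph.induce_singleton_eq_top]
    exact SimpleGraph.connected_top
  · rw [Set.disjoint_singleton]
    exact fun h => hab (P.equivFin.symm.injective (Subtype.ext h))
  · refine ⟨_, rfl, _, rfl, (hP _ (P.equivFin.symm a).2 _).2 ⟨(P.equivFin.symm b).2, ?_⟩⟩
    exact fun h => hab (P.equivFin.symm.injective (Subtype.ext h))

/-- The branch sets are the edges `{u, φ u}` of a matching. -/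
lemma card_le_hadwiger_of_complete_bipartite (hG : IsCompleteBetween G P Q) (hPQ : Disjoint P Q)
    (hφ : Set.InjOn φ P) (hφQ : ∀ u ∈ P, φ u ∈ Q) : P.card ≤ hadwiger n G := by
  set u : Fin P.card → Fin n := fun a => (P.equivFin.symm a).1 with hu
  have huP : ∀ a, u a ∈ P := fun a => (P.equivFin.symm a).2
  have hinj : ∀ a b, u a = u b → a = b := fun a b h =>
    P.equivFin.symm.injective (Subtype.ext h)
  refine le_hadwiger ⟨fun a => {u a, φ (u a)}, fun a => ?_, fun a b hab => ?_, fun a b hab => ?_⟩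
  · exact SimpleGraph.induce_pair_connected_of_adj
      ((hG _ _).2 (Or.inl ⟨huP a, hφQ _ (huP a)⟩))
  · rw [Set.disjoint_left]
    rintro x (rfl | rfl) (hx | hx)
    · exact hab (hinj _ _ hx)
    · exact Finset.disjoint_left.1 hPQ (huP a) (hx ▸ hφQ _ (huP b))
    · exact Finset.disjoint_left.1 hPQ (huP b) (hx ▸ hφQ _ (huP a))
    · exact hab (hinj _ _ (hφ (huP a) (huP b) hx))
  · exact ⟨u a, Or.inl rfl, φ (u b), Or.inr rfl, (hG _ _).2 (Or.inl ⟨huP a, hφQ _ (huP b)⟩)⟩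

end Hadwiger
/-! ### Block decompositions -/

section Blocks

variable {r l n : ℕ}

/-- A surjection onto `Fin r` that is injective at the points of `N`. -/
lemma exists_surjection_separating {X : Type*} [Fintype X] [DecidableEq X] (N : Finset X)
    (h1 : N.card < r) (h2 : r ≤ Fintype.card X) :
    ∃ g : X → Fin r, Function.Surjective g ∧ ∀ x ∈ N, ∀ y, g x = g y → x = y := by
  obtain ⟨Y, hNY, -, hY⟩ := Finset.exists_subsuperset_card_eq (Finset.subset_univ N) h1.le
    (by rwa [Finset.card_univ])
  -- All points outside `Y` will share the value of `y₀`, a point outside `N`.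
  obtain ⟨y₀, hy₀, hy₀N⟩ := Finset.exists_mem_notMem_of_card_lt_card (h1.trans_eq hY.symm)
  set e := Y.equivFinOfCardEq hY
  refine ⟨fun x => if h : x ∈ Y then e ⟨x, h⟩ else e ⟨y₀, hy₀⟩, fun i => ?_, fun x hx y hxy => ?_⟩
  · exact ⟨(e.symm i).1, by simp⟩
  · simp only [hNY hx, dif_pos] at hxy
    split_ifs at hxy with hy
    · exact congrArg Subtype.val (e.injective hxy)
    · have : x = y₀ := congrArg Subtype.val (e.injective hxy)
      exact absurd (this ▸ hx) hy₀N

/-- The residue class of `a` modulo `l`. -/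
def residueClass (n : ℕ) (a : Fin l) : Finset (Fin n) :=
  Finset.univ.filter fun u => u.val % l = a.val

lemma mem_residueClass {a : Fin l} {u : Fin n} : u ∈ residueClass n a ↔ u.val % l = a.val := by
  simp [residueClass]

lemma le_card_residueClass (n : ℕ) (a : Fin l) : n / l ≤ (residueClass n a).card := by
  have hl : 0 < l := a.pos
  have hlt : ∀ t : Fin (n / l), l * t.val + a.val < n := by
    intro t
    calc l * t.val + a.val < l * t.val + l := Nat.add_lt_add_left a.isLt _
      _ = l * (t.val + 1) := by ring
      _ ≤ l * (n / l) := Nat.mul_le_mul_left _ t.isLt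
      _ ≤ n := Nat.mul_div_le n l
  have h := Finset.card_le_card_of_injOn (s := (Finset.univ : Finset (Fin (n / l))))
    (t := residueClass n a) (fun t => ⟨l * t.val + a.val, hlt t⟩) ?_ ?_
  · simpa using h
  · intro t _
    rw [Finset.mem_coe, mem_residueClass]
    simp [Nat.mod_eq_of_lt a.isLt]
  · intro s _ t _ hst
    have h1 : l * s.val + a.val = l * t.val + a.val := congrArg Fin.val hst
    exact Fin.ext (Nat.eq_of_mul_eq_mul_left hl (by omega))

lemma disjoint_residueClass {a b : Fin l} (hab : a ≠ b) :
    Disjoint (residueClass n a) (residueClass n b) := by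
  rw [Finset.disjoint_left]
  intro u ha hb
  rw [mem_residueClass] at ha hb
  exact hab (Fin.ext (ha.symm.trans hb))

/-- The translation from the residue class of `a` to that of `b`, where `b < a`. -/
def shift (n : ℕ) (a b : Fin l) (u : Fin n) : Fin n :=
  ⟨u.val - (a.val - b.val), (Nat.sub_le _ _).trans_lt u.isLt⟩

lemma le_of_mem_residueClass {a : Fin l} {u : Fin n} (hu : u ∈ residueClass n a) :
    a.val ≤ u.val := (mem_residueClass.1 hu) ▸ Nat.mod_le _ _

lemma shift_injOn (a b : Fin l) : Set.InjOn (shift n a b) (residueClass n a) := by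
  intro u hu v hv huv
  have h1 := le_of_mem_residueClass hu
  have h2 := le_of_mem_residueClass hv
  have h3 : u.val - (a.val - b.val) = v.val - (a.val - b.val) := congrArg Fin.val huv
  exact Fin.ext (by omega)

lemma shift_mem {a b : Fin l} (hba : b < a) {u : Fin n} (hu : u ∈ residueClass n a) :
    shift n a b u ∈ residueClass n b := by
  have h1 := le_of_mem_residueClass hu
  rw [mem_residueClass] at hu ⊢
  have h2 : b.val < a.val := hba
  have h3 := Nat.div_add_mod u.val l
  have h4 : u.val - (a.val - b.val) = l * (u.val / l) + b.val := by omega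
  change (u.val - (a.val - b.val)) % l = b.val
  rw [h4, Nat.mul_add_mod, Nat.mod_eq_of_lt b.isLt]

/-- The clique `P` is a component of `G`, or `G` consists of isolated vertices and a complete
bipartite graph with smaller side `P`. -/
def IsBlock (G : SimpleGraph (Fin n)) (P : Finset (Fin n)) : Prop :=
  (∀ u ∈ P, ∀ v, G.Adj u v ↔ v ∈ P ∧ u ≠ v) ∨
    ∃ (Q : Finset (Fin n)) (φ : Fin n → Fin n), IsCompleteBetween G P Q ∧ Disjoint P Q ∧
      Set.InjOn φ P ∧ ∀ u ∈ P, φ u ∈ Q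

/-- The decomposition of `K_n` into blocks on the residue classes modulo `l`. -/
theorem exists_block_decomposition (n : ℕ) (h1 : l.choose 2 < r) (h2 : r ≤ (l + 1).choose 2) :
    ∃ G : Fin r → SimpleGraph (Fin n), IsDecomposition G ∧
      ∀ i, ∃ P, n / l ≤ P.card ∧ IsBlock (G i) P := by
  classical
  have hl : 0 < l := by
    rcases Nat.eq_zero_or_pos l with rfl | h
    · simp at h1 h2; omega
    · exact h
  -- An unordered pair of classes stands for a bipartite graph, or for a clique if the pair is
  -- diagonal. The nondiagonal pairs, `l.choose 2` in number, get colours of their own.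
  obtain ⟨g, hg, hgN⟩ := exists_surjection_separating (r := r)
    ((Finset.univ : Finset (Sym2 (Fin l))).filter fun e => ¬ e.IsDiag)
    (by rwa [← Fintype.card_subtype, Sym2.card_subtype_not_diag, Fintype.card_fin])
    (by rwa [Sym2.card, Fintype.card_fin])
  have hgN' : ∀ x y : Sym2 (Fin l), ¬ x.IsDiag → g x = g y → x = y :=
    fun x y hx => hgN x (by simpa using hx) y
  set c : Fin n → Fin l := fun u => ⟨u.val % l, Nat.mod_lt _ hl⟩ with hc
  have hmem : ∀ (a : Fin l) (u : Fin n), u ∈ residueClass n a ↔ c u = a := by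
    intro a u
    rw [mem_residueClass, hc, Fin.ext_iff]
  refine ⟨_, isDecomposition_colorGraph fun e => g (e.map c), fun i => ?_⟩
  have hadj : ∀ u v, (colorGraph (fun e => g (e.map c)) i).Adj u v ↔
      u ≠ v ∧ g s(c u, c v) = i := fun u v => Iff.rfl
  obtain ⟨x, rfl⟩ := hg i
  induction x using Sym2.ind with
  | _ a b =>
    by_cases hab : a = b
    · subst hab
      refine ⟨residueClass n a, le_card_residueClass n a, Or.inl fun u hu v => ?_⟩
      rw [hmem] at hu
      rw [hadj, hmem, hu, and_comm]
      refine and_congr_left fun _ => ⟨fun h => ?_, fun h => by rw [h]⟩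
      -- An edge of this colour leaving the class would come from a nondiagonal pair, which shares
      -- its colour with no other pair.
      by_contra hne
      have := hgN' s(a, c v) s(a, a) (by simpa [eq_comm] using hne) h
      simp at this
      exact hne this
    -- The class with the larger index is the smaller side: translation injects it into the other.
    · have key : ∀ a b : Fin l, b < a → IsBlock
          (colorGraph (fun e => g (e.map c)) (g s(a, b)) : SimpleGraph (Fin n))
          (residueClass n a) := by
        intro a b hba
        refine Or.inr ⟨residueClass n b, shift n a b, fun u v => ?_,
          disjoint_residueClass hba.ne', shift_injOn a b, fun u hu => shift_mem hba hu⟩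
        have h0 : g s(c u, c v) = g s(a, b) ↔ s(c u, c v) = s(a, b) :=
          ⟨fun h => (hgN' _ _ (by simpa using hba.ne') h.symm).symm, fun h => by rw [h]⟩
        change u ≠ v ∧ g s(c u, c v) = g s(a, b) ↔ _
        rw [h0, Sym2.eq_iff, hmem, hmem, hmem, hmem]
        constructor
        · rintro ⟨-, h | h⟩
          · exact Or.inl h
          · exact Or.inr ⟨h.2, h.1⟩
        · rintro (⟨rfl, rfl⟩ | ⟨rfl, rfl⟩)
          · exact ⟨by rintro rfl; exact hba.ne rfl, Or.inl ⟨rfl, rfl⟩⟩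
          · exact ⟨by rintro rfl; exact hba.ne rfl, Or.inr ⟨rfl, rfl⟩⟩
      rcases lt_or_gt_of_ne hab with h | h
      · rw [Sym2.eq_swap]
        exact ⟨_, le_card_residueClass n b, key b a h⟩
      · exact ⟨_, le_card_residueClass n a, key a b h⟩

variable {G : SimpleGraph (Fin n)} {P : Finset (Fin n)}

lemma IsBlock.card_le_hadwiger (h : IsBlock G P) : P.card ≤ hadwiger n G := by
  rcases h with h | ⟨Q, φ, h1, h2, h3, h4⟩
  · exact card_le_hadwiger_of_clique h
  · exact card_le_hadwiger_of_complete_bipartite h1 h2 h3 h4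

lemma IsBlock.card_le_cdvNu (h : IsBlock G P) (hP : 3 ≤ P.card) : P.card ≤ cdvNu n G + 1 := by
  rcases h with h | ⟨Q, φ, h1, h2, h3, h4⟩
  · exact card_le_cdvNu_of_clique h (Finset.card_pos.1 (by omega))
  · exact (card_le_cdvNu_of_complete_bipartite h1 h2 h3 h4
      (hP.trans (Finset.card_le_card_of_injOn φ h4 h3))).trans (Nat.le_succ _)

lemma IsBlock.card_le_cdvMu (h : IsBlock G P) (hP : 3 ≤ P.card) : P.card ≤ cdvMu n G + 1 := by
  have hne : P.Nonempty := Finset.card_pos.1 (by omega)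
  rcases h with h | ⟨Q, φ, h1, h2, h3, h4⟩
  · exact card_le_cdvMu_of_clique h hne
  · exact card_le_cdvMu_of_complete_bipartite h1 h2 h3 h4 hne

end Blocks
/-! ### Asymptotics -/

section Asymptotics

variable {r : ℕ}

lemma prod_le_mean_pow (hr : 0 < r) (z : Fin r → ℝ) (hz : ∀ i, 0 ≤ z i) :
    ∏ i, z i ≤ ((∑ i, z i) / r) ^ r := by
  have hr' : (r : ℝ) ≠ 0 := by positivity
  have h := Real.geom_mean_le_arith_mean_weighted Finset.univ (fun _ : Fin r => (r : ℝ)⁻¹) z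
    (fun _ _ => by positivity) (by simp [hr']) fun i _ => hz i
  rw [Real.finsetProd_rpow _ _ fun i _ => hz i, ← Finset.mul_sum] at h
  have h0 : 0 ≤ ∏ i, z i := Finset.prod_nonneg fun i _ => hz i
  calc ∏ i, z i = ((∏ i, z i) ^ (r : ℝ)⁻¹) ^ r := (Real.rpow_inv_natCast_pow h0 hr.ne').symm
    _ ≤ ((r : ℝ)⁻¹ * ∑ i, z i) ^ r := pow_le_pow_left₀ (Real.rpow_nonneg h0 _) h r
    _ = _ := by rw [inv_mul_eq_div]

open Classical in
/-- The upper bound for parameters with `β² ≤ 2 (|V| + |E|)`. -/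
lemma ngProdUpper_div_le {β : GraphParameter} (hr : 0 < r)
    (hβ : ∀ n (G : SimpleGraph (Fin n)), β n G ^ 2 ≤ 2 * n + 2 * G.edgeFinset.card) {n : ℕ}
    (hn : 0 < n) :
    (ngProdUpper β r n : ℝ) / (n : ℝ) ^ r ≤ √((1 + 2 * r / n) / r) ^ r := by
  obtain ⟨G, hG, hGeq⟩ := exists_ngProdUpper_eq β hr n
  have hn' : (0 : ℝ) < n := by exact_mod_cast hn
  have hr' : (0 : ℝ) < r := by exact_mod_cast hr
  have hsumN : ∑ i, β n (G i) ^ 2 ≤ n ^ 2 + 2 * r * n := by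
    calc ∑ i, β n (G i) ^ 2 ≤ ∑ i, (2 * n + 2 * (G i).edgeFinset.card) :=
          Finset.sum_le_sum fun i _ => hβ n (G i)
      _ = 2 * r * n + 2 * n.choose 2 := by
          rw [Finset.sum_add_distrib, ← Finset.mul_sum _ _ 2, ← Finset.mul_sum _ _ 2, hG.sum_card_edgeFinset]
          simp
          ring
      _ ≤ n ^ 2 + 2 * r * n := by
          have : 2 * n.choose 2 ≤ n ^ 2 := by
            obtain ⟨m, rfl⟩ : ∃ m, n = m + 1 := ⟨n - 1, by omega⟩
            rw [two_mul_choose_two]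
            nlinarith
          omega
  have hsum : ∑ i, (β n (G i) : ℝ) ^ 2 ≤ (n : ℝ) ^ 2 + 2 * r * n := by exact_mod_cast hsumN
  -- The inequality of the means is applied to the squares, since it is their sum that is bounded.
  have hprod : (ngProdUpper β r n : ℝ) ^ 2 ≤ (((n : ℝ) ^ 2 + 2 * r * n) / r) ^ r := by
    rw [hGeq, Nat.cast_prod, ← Finset.prod_pow]
    refine (prod_le_mean_pow hr _ fun i => sq_nonneg _).trans ?_
    gcongr
  have h1 : ((n : ℝ) ^ 2 + 2 * r * n) / r = (n : ℝ) ^ 2 * ((1 + 2 * r / n) / r) := by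
    field_simp
  rw [div_le_iff₀ (by positivity), ← mul_pow]
  refine le_of_sq_le_sq ?_ (by positivity)
  refine hprod.trans (le_of_eq ?_)
  rw [h1, ← pow_mul, mul_comm r 2, pow_mul, mul_pow (√_), Real.sq_sqrt (by positivity)]
  ring

/-- The number under the ceiling is the positive root of `x * (x + 1) = 2 * r`, so `l` is the least
natural number with `2 * r ≤ l * (l + 1)`. -/
lemma choose_bounds_of_ceil {l : ℕ} (hr : 0 < r)
    (hl : ⌈√(2 * (r : ℝ) + 1 / 4) - 1 / 2⌉ = (l : ℤ)) :
    l.choose 2 < r ∧ r ≤ (l + 1).choose 2 := by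
  have hr' : (1 : ℝ) ≤ r := by exact_mod_cast hr
  set y := √(2 * (r : ℝ) + 1 / 4) with hy
  have hy2 : y ^ 2 = 2 * r + 1 / 4 := Real.sq_sqrt (by positivity)
  have hy0 : 0 ≤ y := Real.sqrt_nonneg _
  have hy1 : 1 / 2 < y := by nlinarith
  obtain ⟨h1, h2⟩ := Int.ceil_eq_iff.1 hl
  rw [Int.cast_natCast] at h1 h2
  have hl0 : 0 < l := by
    rcases Nat.eq_zero_or_pos l with rfl | h
    · norm_num at h2; linarith
    · exact h
  obtain ⟨m, rfl⟩ : ∃ m, l = m + 1 := ⟨l - 1, by omega⟩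
  push_cast at h1 h2
  have hm : (0 : ℝ) ≤ m := Nat.cast_nonneg m
  have e1 : (m : ℝ) * (m + 1) < 2 * r := by nlinarith
  have e2 : 2 * (r : ℝ) ≤ (m + 1) * (m + 1 + 1) := by nlinarith
  have f1 : m * (m + 1) < 2 * r := by exact_mod_cast e1
  have f2 : 2 * r ≤ (m + 1) * (m + 1 + 1) := by exact_mod_cast e2
  rw [← two_mul_choose_two] at f1 f2
  omega

/-- The lower bound for parameters that are large on blocks. -/
lemma le_ngProdUpper_div {β : GraphParameter} {l : ℕ} (hl0 : 0 < l) (h1 : l.choose 2 < r)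
    (h2 : r ≤ (l + 1).choose 2)
    (hβ : ∀ n (G : SimpleGraph (Fin n)) (P : Finset (Fin n)), IsBlock G P → 3 ≤ P.card →
      P.card ≤ β n G + 1) {n : ℕ} (hn : 3 * l ≤ n) :
    ((l : ℝ)⁻¹ - 2 / n) ^ r ≤ (ngProdUpper β r n : ℝ) / (n : ℝ) ^ r := by
  obtain ⟨G, hG, hblock⟩ := exists_block_decomposition n h1 h2
  have h3 : 3 ≤ n / l := (Nat.le_div_iff_mul_le hl0).2 hn
  have hn' : (0 : ℝ) < n := by
    have : 0 < n := by omega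
    exact_mod_cast this
  have hl' : (0 : ℝ) < l := by exact_mod_cast hl0
  have h4 : (n / l - 1) ^ r ≤ ngProdUpper β r n := by
    refine pow_le_ngProdUpper β hG fun i => ?_
    obtain ⟨P, hP, hPb⟩ := hblock i
    have := hβ n (G i) P hPb (h3.trans hP)
    omega
  have h5 : ((n / l - 1 : ℕ) : ℝ) ^ r ≤ ngProdUpper β r n := by exact_mod_cast h4
  rw [le_div_iff₀ (by positivity), ← mul_pow]
  refine le_trans (pow_le_pow_left₀ ?_ ?_ r) h5
  · have h6 : (l : ℝ)⁻¹ * n ≥ 3 := by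
      rw [inv_mul_eq_div, ge_iff_le, le_div_iff₀ hl']
      exact_mod_cast hn
    rw [sub_mul, div_mul_cancel₀ _ hn'.ne']
    linarith
  -- The `2` in `2 / n` pays for rounding `n / l` down and for the loss of one in `hβ`.
  · rw [sub_mul, div_mul_cancel₀ _ hn'.ne', inv_mul_eq_div, Nat.cast_sub (by omega), Nat.cast_one]
    have h7 : (n : ℝ) / l < (n / l : ℕ) + 1 := by
      rw [div_lt_iff₀ hl']
      have := Nat.lt_mul_div_succ n hl0
      rw [mul_comm] at this
      exact_mod_cast this
    linarith

lemma tendsto_const_div_natCast (c : ℝ) : Tendsto (fun n : ℕ => c / (n : ℝ)) atTop (𝓝 0) :=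
  tendsto_const_nhds.div_atTop tendsto_natCast_atTop_atTop

open Classical in
/-- The order of magnitude of the product upper bound for parameters that are quadratically bounded
by the number of edges and large on blocks. -/
theorem ngProdUpper_asymptotics {β : GraphParameter} (hr : 0 < r)
    (hup : ∀ n (G : SimpleGraph (Fin n)), β n G ^ 2 ≤ 2 * n + 2 * G.edgeFinset.card)
    (hlo : ∀ n (G : SimpleGraph (Fin n)) (P : Finset (Fin n)), IsBlock G P → 3 ≤ P.card →
      P.card ≤ β n G + 1) :
    (fun n : ℕ => (ngProdUpper β r n : ℝ)) =Θ[atTop] (fun n : ℕ => (n : ℝ) ^ r) ∧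
      ∃ ε δ : ℕ → ℝ,
        ε =o[atTop] (fun _ : ℕ => (1 : ℝ)) ∧ δ =o[atTop] (fun _ : ℕ => (1 : ℝ)) ∧
        ∀ᶠ n : ℕ in atTop,
          ((⌈√(2 * (r : ℝ) + 1 / 4) - 1 / 2⌉ : ℤ) : ℝ) ^ (-(r : ℤ)) - ε n ≤
              (ngProdUpper β r n : ℝ) / (n : ℝ) ^ r ∧
          (ngProdUpper β r n : ℝ) / (n : ℝ) ^ r ≤ (√(r : ℝ)) ^ (-(r : ℤ)) + δ n := by
  have hr' : (0 : ℝ) < r := by exact_mod_cast hr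
  have hceil : 0 < ⌈√(2 * (r : ℝ) + 1 / 4) - 1 / 2⌉ := by
    rw [Int.ceil_pos, sub_pos, Real.lt_sqrt (by norm_num)]
    norm_num
    exact hr
  obtain ⟨l, hl⟩ := Int.eq_ofNat_of_zero_le hceil.le
  have hl0 : 0 < l := by omega
  have hl' : (0 : ℝ) < l := by exact_mod_cast hl0
  obtain ⟨h1, h2⟩ := choose_bounds_of_ceil hr hl
  rw [hl, Int.cast_natCast, zpow_neg, zpow_neg, zpow_natCast, zpow_natCast]
  set a : ℝ := ((l : ℝ) ^ r)⁻¹ with ha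
  set b : ℝ := (√(r : ℝ) ^ r)⁻¹ with hb
  have ha0 : 0 < a := by positivity
  have hb0 : 0 < b := by positivity
  set L : ℕ → ℝ := fun n => ((l : ℝ)⁻¹ - 2 / n) ^ r with hL
  set U : ℕ → ℝ := fun n => √((1 + 2 * r / n) / r) ^ r with hU
  have hLlim : Tendsto L atTop (𝓝 a) := by
    have := ((tendsto_const_nhds (x := (l : ℝ)⁻¹)).sub (tendsto_const_div_natCast 2)).pow r
    rwa [sub_zero, inv_pow] at this
  have hUlim : Tendsto U atTop (𝓝 b) := by
    have h3 := ((tendsto_const_nhds (x := (1 : ℝ))).add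
      (tendsto_const_div_natCast (2 * r))).div_const (r : ℝ)
    have h4 := ((Real.continuous_sqrt.tendsto _).comp h3).pow r
    rwa [add_zero, one_div, Real.sqrt_inv, inv_pow] at h4
  have hbounds : ∀ᶠ n : ℕ in atTop, 0 < n ∧ L n ≤ (ngProdUpper β r n : ℝ) / (n : ℝ) ^ r ∧
      (ngProdUpper β r n : ℝ) / (n : ℝ) ^ r ≤ U n := by
    filter_upwards [eventually_ge_atTop (3 * l), eventually_gt_atTop 0] with n hn hn0
    exact ⟨hn0, le_ngProdUpper_div hl0 h1 h2 hlo hn, ngProdUpper_div_le hr hup hn0⟩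
  -- The error terms are the distances of the explicit bounds `L` and `U` from their limits.
  refine ⟨⟨?_, ?_⟩, fun n => a - L n, fun n => U n - b, ?_, ?_, ?_⟩
  · refine IsBigO.of_bound (b + 1) ?_
    filter_upwards [hbounds, hUlim.eventually_lt_const (lt_add_one b)] with n hn hn'
    have hpos : (0 : ℝ) < (n : ℝ) ^ r := pow_pos (by exact_mod_cast hn.1) r
    rw [Real.norm_of_nonneg (by positivity), Real.norm_of_nonneg hpos.le]
    exact (div_le_iff₀ hpos).1 (hn.2.2.trans hn'.le)
  · refine IsBigO.of_bound (a / 2)⁻¹ ?_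
    filter_upwards [hbounds, hLlim.eventually_const_lt (half_lt_self ha0)] with n hn hn'
    have hpos : (0 : ℝ) < (n : ℝ) ^ r := pow_pos (by exact_mod_cast hn.1) r
    rw [Real.norm_of_nonneg hpos.le, Real.norm_of_nonneg (Nat.cast_nonneg _),
      inv_mul_eq_div, le_div_iff₀ (by positivity), mul_comm]
    exact (le_div_iff₀ hpos).1 (hn'.le.trans hn.2.1)
  · rw [isLittleO_one_iff]
    simpa using hLlim.const_sub a
  · rw [isLittleO_one_iff]
    simpa using hUlim.sub_const b
  · filter_upwards [hbounds] with n hn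
    exact ⟨by linarith [hn.2.1], by linarith [hn.2.2]⟩

/-- Take `C` with `(1 - 1/r) ^ C < 1/8`. Then the power at `s * s ≥ C * n` is at most `8⁻ⁿ`, which
beats `r * 4 ^ n` because `r ≤ n < 2 ^ n`. -/
lemma exists_pow_sq_bound (hr : 2 ≤ r) : ∃ C : ℕ, ∀ n s : ℕ, r ≤ n → C * n ≤ s * s →
    r * 4 ^ n * (r - 1) ^ (s * s) < r ^ (s * s) := by
  have hr' : (2 : ℝ) ≤ r := by exact_mod_cast hr
  set q : ℝ := (r - 1) / r with hq
  have hq0 : 0 ≤ q := div_nonneg (by linarith) (by linarith)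
  have hq1 : q < 1 := by rw [hq, div_lt_one (by linarith)]; linarith
  obtain ⟨C, hC⟩ := exists_pow_lt_of_lt_one (show (0 : ℝ) < 1 / 8 by norm_num) hq1
  refine ⟨C, fun n s hn hs => ?_⟩
  have h1 : q ^ (s * s) ≤ (1 / 8) ^ n := by
    calc q ^ (s * s) ≤ q ^ (C * n) := pow_le_pow_of_le_one hq0 hq1.le hs
      _ = (q ^ C) ^ n := pow_mul _ _ _
      _ ≤ (1 / 8) ^ n := pow_le_pow_left₀ (pow_nonneg hq0 _) hC.le n
  have h2 : (r : ℝ) < 2 ^ n := by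
    exact_mod_cast hn.trans_lt (Nat.lt_two_pow_self)
  have h3 : (r : ℝ) * 4 ^ n * q ^ (s * s) < 1 := by
    calc (r : ℝ) * 4 ^ n * q ^ (s * s) ≤ r * 4 ^ n * (1 / 8) ^ n := by gcongr
      _ < 2 ^ n * 4 ^ n * (1 / 8) ^ n := by gcongr
      _ = 1 := by rw [← mul_pow, ← mul_pow]; norm_num
  have hrpos : (0 : ℝ) < (r : ℝ) ^ (s * s) := by positivity
  rw [hq, div_pow, ← mul_div_assoc, div_lt_one hrpos] at h3
  have h4 : ((r - 1 : ℕ) : ℝ) = (r : ℝ) - 1 := by rw [Nat.cast_sub (by omega), Nat.cast_one]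
  rw [← h4] at h3
  exact_mod_cast h3

/-- The product upper bound for the width parameters. -/
theorem tendsto_ngProdUpper_widthOf {P : ℕ → ∀ m : ℕ, SimpleGraph (Fin m) → Prop}
    (hP : ∀ k, P k (k + 1) ⊤) (hP' : ∀ k m H, P k m H → IsKTree k H) (hr : 2 ≤ r) :
    Tendsto (fun n : ℕ => (ngProdUpper (widthOf P) r n : ℝ) / (n : ℝ) ^ r) atTop (𝓝 1) := by
  obtain ⟨C, hC⟩ := exists_pow_sq_bound hr
  -- Large enough for `C * n ≤ s * s`, yet `o(n)`.
  set s : ℕ → ℕ := fun n => Nat.sqrt (C * n) + 1 with hs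
  have hslim : Tendsto (fun n : ℕ => (s n : ℝ) / n) atTop (𝓝 0) := by
    have h1 : Tendsto (fun n : ℕ => √(C / (n : ℝ)) + 1 / n) atTop (𝓝 0) := by
      have := ((Real.continuous_sqrt.tendsto _).comp (tendsto_const_div_natCast C)).add
        (tendsto_const_div_natCast 1)
      simpa using this
    refine squeeze_zero' (Eventually.of_forall fun n => by positivity) ?_ h1
    filter_upwards [eventually_gt_atTop 0] with n hn
    have hn' : (0 : ℝ) < n := by exact_mod_cast hn
    have h2 : (Nat.sqrt (C * n) : ℝ) ≤ √((C : ℝ) * n) := by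
      exact_mod_cast Real.nat_sqrt_le_real_sqrt (a := C * n)
    have h3 : √((C : ℝ) * n) = √(C / (n : ℝ)) * n := by
      rw [← Real.sqrt_sq hn'.le, ← Real.sqrt_mul (by positivity), Real.sqrt_sq hn'.le]
      congr 1
      field_simp
    have h4 : (Nat.sqrt (C * n) : ℝ) / n ≤ √(C / (n : ℝ)) := (div_le_iff₀ hn').2 (h3 ▸ h2)
    rw [hs, Nat.cast_add, Nat.cast_one, add_div]
    linarith
  have hlow : Tendsto (fun n : ℕ => (1 - 4 * ((s n : ℝ) / n)) ^ r) atTop (𝓝 1) := by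
    have := ((tendsto_const_nhds (x := (1 : ℝ))).sub (hslim.const_mul 4)).pow r
    simpa using this
  refine tendsto_of_tendsto_of_tendsto_of_le_of_le' hlow tendsto_const_nhds ?_ ?_
  · have hsmall : ∀ᶠ n : ℕ in atTop, (s n : ℝ) / n < 1 / 4 :=
      hslim.eventually_lt_const (by norm_num)
    filter_upwards [eventually_ge_atTop r, hsmall] with n hn hsn
    have hn' : (0 : ℝ) < n := by
      have : 0 < n := by omega
      exact_mod_cast this
    obtain ⟨f, hf⟩ := exists_coloring_joining (n := n) (by omega)
      (hC n (s n) hn (Nat.lt_succ_sqrt (C * n)).le)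
    have h1 : (n - 4 * s n) ^ r ≤ ngProdUpper (widthOf P) r n :=
      pow_le_ngProdUpper _ (isDecomposition_colorGraph f) fun i =>
        Nat.sub_le_iff_le_add.2 (le_widthOf hP hP' (Nat.succ_pos _) (hf i))
    have h2 : ((n - 4 * s n : ℕ) : ℝ) ^ r ≤ ngProdUpper (widthOf P) r n := by exact_mod_cast h1
    rw [div_lt_iff₀ hn'] at hsn
    have h3 : 4 * s n ≤ n := by
      have : 4 * (s n : ℝ) ≤ n := by linarith
      exact_mod_cast this
    rw [Nat.cast_sub h3] at h2
    push_cast at h2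
    rw [le_div_iff₀ (by positivity), ← mul_pow]
    refine le_trans (le_of_eq ?_) h2
    congr 1
    field_simp
  · filter_upwards [eventually_gt_atTop 0] with n hn
    have hn' : (0 : ℝ) < n := by exact_mod_cast hn
    obtain ⟨G, -, hGeq⟩ := exists_ngProdUpper_eq (widthOf P) (show 0 < r by omega) n
    rw [div_le_one (by positivity), hGeq]
    have : ∏ i, widthOf P n (G i) ≤ n ^ r := by
      calc ∏ i, widthOf P n (G i) ≤ ∏ _i : Fin r, n :=
            Finset.prod_le_prod' fun i _ => widthOf_le hP _
        _ = n ^ r := by simp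
    exact_mod_cast this

end Asymptotics
end NordhausGaddum

theorem theorem1p4 (r : ℕ) (hr : 2 ≤ r) :
    (∀ β ∈ ({NordhausGaddum.treeWidth, NordhausGaddum.largeurArborescence,
          NordhausGaddum.pathWidth, NordhausGaddum.properPathWidth} :
          Set NordhausGaddum.GraphParameter),
      Tendsto (fun n : ℕ => (NordhausGaddum.ngProdUpper β r n : ℝ) / (n : ℝ) ^ r)
        atTop (𝓝 1)) ∧
    (∀ β ∈ ({NordhausGaddum.hadwiger, NordhausGaddum.cdvNu,
          NordhausGaddum.cdvMu, NordhausGaddum.cdvXi} :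
          Set NordhausGaddum.GraphParameter),
      (fun n : ℕ => (NordhausGaddum.ngProdUpper β r n : ℝ)) =Θ[atTop]
          (fun n : ℕ => (n : ℝ) ^ r) ∧
      ∃ ε δ : ℕ → ℝ,
        ε =o[atTop] (fun _ : ℕ => (1 : ℝ)) ∧ δ =o[atTop] (fun _ : ℕ => (1 : ℝ)) ∧
        ∀ᶠ n : ℕ in atTop,
          ((⌈√(2 * (r : ℝ) + 1 / 4) - 1 / 2⌉ : ℤ) : ℝ) ^ (-(r : ℤ)) - ε n ≤
              (NordhausGaddum.ngProdUpper β r n : ℝ) / (n : ℝ) ^ r ∧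
          (NordhausGaddum.ngProdUpper β r n : ℝ) / (n : ℝ) ^ r ≤
              (√(r : ℝ)) ^ (-(r : ℤ)) + δ n) := by
  refine ⟨?_, ?_⟩
  · rintro β (rfl | rfl | rfl | rfl)
    -- Each of the four width parameters unfolds to `widthOf` of its class of graphs.
    · exact NordhausGaddum.tendsto_ngProdUpper_widthOf
        (fun k => (NordhausGaddum.isLinearKTree_top k).toIsKTree) (fun _ _ _ h => h) hr
    · exact NordhausGaddum.tendsto_ngProdUpper_widthOf
        NordhausGaddum.isTwoSidedKTree_top (fun _ _ _ h => h.toIsKTree) hr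
    · exact NordhausGaddum.tendsto_ngProdUpper_widthOf
        NordhausGaddum.isKCaterpillar_top (fun _ _ _ h => h.toIsKTree) hr
    · exact NordhausGaddum.tendsto_ngProdUpper_widthOf
        NordhausGaddum.isLinearKTree_top (fun _ _ _ h => h.toIsKTree) hr
  · have hr0 : 0 < r := by omega
    -- The upper bounds for `ν` and `μ` come from `ξ`, and the lower bound for `ξ` comes from `ν`.
    rintro β (rfl | rfl | rfl | rfl)
    · exact NordhausGaddum.ngProdUpper_asymptotics hr0 (fun _ G => NordhausGaddum.hadwiger_sq_le G)
        fun _ _ _ h _ => h.card_le_hadwiger.trans (Nat.le_succ _)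
    · exact NordhausGaddum.ngProdUpper_asymptotics hr0
        (fun _ G => (Nat.pow_le_pow_left (NordhausGaddum.cdvNu_le_cdvXi G) 2).trans
          (NordhausGaddum.cdvXi_sq_le G))
        fun _ _ _ h hP => h.card_le_cdvNu hP
    · exact NordhausGaddum.ngProdUpper_asymptotics hr0
        (fun _ G => (Nat.pow_le_pow_left (NordhausGaddum.cdvMu_le_cdvXi G) 2).trans
          (NordhausGaddum.cdvXi_sq_le G))
        fun _ _ _ h hP => h.card_le_cdvMu hP
    · exact NordhausGaddum.ngProdUpper_asymptotics hr0 (fun _ G => NordhausGaddum.cdvXi_sq_le G)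
        fun _ G _ h hP => (h.card_le_cdvNu hP).trans
          (Nat.add_le_add_right (NordhausGaddum.cdvNu_le_cdvXi G) 1)
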